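/- \textbf{Proposition (Co-exploration constraint).} Fix finite sets of states $\mathcal S$ and of actions $\mathcal A(s)$, $s \in \mathcal S$, and let $\mathcal X = \{(s,a) : s \in \mathcal S, a \in \mathcal A(s)\}$ be the set of pairs. A model $M$ consists of a transition distribution $p(\cdot|x)$ on $\mathcal S$ and a reward distribution $q(x)$ on $\mathbb R$ with finite mean $r(x)$ for every pair $x \in \mathcal X$; it is communicating if every state can be reached from every state with positive probability. A learner chooses, possibly at random, each action $A_t \in \mathcal A(S_t)$ as a function of the history $S_1, A_1, R_1, \ldots, S_{t-1}, A_{t-1}, R_{t-1}, S_t$; given the history and the pair $X_t = (S_t, A_t)$, the reward $R_t \sim q(X_t)$ and the next state $S_{t+1} \sim p(\cdot|X_t)$ are drawn independently. Write $\mathbb E_{s_0}^{M,\Lambda}$ for the expectation when the learner $\Lambda$ interacts with $M$ from $S_1 = s_0$, and $N_{T+1}(x) = \sum_{t=1}^{T} \mathbf 1\{X_t = x\}$. The gain of a stationary randomized policy $\pi$ is $g^\pi(s; M) = \lim_{T\to\infty} \frac1T \mathbb E_s^{M,\pi}\left[\sum_{t=1}^T R_t\right]$, the optimal gain is $g^*(s;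 M) = \sup_\pi g^\pi(s; M)$, and $\pi$ is gain-optimal if $g^\pi(s; M) = g^*(s; M)$ for all $s$. A pair is optimal for $M$ if it is recurrent under some gain-optimal stationary policy (that is, its state is recurrent in the Markov chain induced by the policy, and the policy plays its action there with positive probability). Given a set $\mathcal M$ of models, a learner $\Lambda$ is consistent if for every $M \in \mathcal M$, every $s_0 \in \mathcal S$ and every $\eta > 0$, the regret satisfies \[ T g^*(s_0; M) - \mathbb E_{s_0}^{M,\Lambda}\left[\sum_{t=1}^T R_t\right] = o(T^\eta) \quad (T \to \infty). \] Let $M \in \mathcal M$ be communicating and let $x_*$ be an optimal pair of $M$. Assume that for every $\epsilon > 0$ there is $M' \in \mathcal M$ such that (1) $M'$ and $M$ have the same transition distributions at all pairs and the same reward distributions at all pairs other than $x_*$, and $q(x_*) \ne q'(x_*)$; (2) $r(x_*) < r'(x_*)$; and (3) $\mathrm{KL}(q(x_*) \,\|\, q'(x_*)) < \epsilon$. Then, for every consistent learner $\Lambda$ and every initial state $s_0 \in \mathcal S$, \[ \lim_{T \to \infty} \frac{\mathbb E_{s_0}^{M,\Lambda}[N_{T+1}(x_*)]}{\log T} = \infty,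 \quad \text{i.e.} \quad \mathbb E_{s_0}^{M,\Lambda}[N_{T+1}(x_*)] = \omega(\log T). \] -/

import Mathlib

open MeasureTheory ProbabilityTheory Filter Asymptotics

universe u

noncomputable section

namespace CoExploration

/-- State-action pairs `(s, a)` with `a` an action available in the state `s`. -/
def Pair {S : Type u} (A : S → Type u) : Type u := Σ s, A s

/-- The state of a pair. -/
def Pair.state {S : Type u} {A : S → Type u} (x : Pair A) : S := x.1

instance {S : Type u} (A : S → Type u) : MeasurableSpace (Pair A) := ⊤

instance {S : Type u} (A : S → Type u) : DiscreteMeasurableSpace (Pair A) :=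
  ⟨fun _ => trivial⟩

/-- A Markov decision process with states `S`, actions `A s` in the state `s`, transition
probabilities `trans x` and reward distributions `reward x` with finite mean. -/
structure MDP (S : Type u) (A : S → Type u) where
  trans : Pair A → PMF S
  reward : Pair A → Measure ℝ
  reward_prob : ∀ x, IsProbabilityMeasure (reward x)
  reward_integrable : ∀ x, Integrable (fun r : ℝ => r) (reward x)

/-- The mean reward of a pair. -/
def MDP.meanReward {S : Type u} {A : S → Type u} (M : MDP S A) (x : Pair A) : ℝ :=
  ∫ r, r ∂(M.reward x)

/-- Every state can be reached from every state with positive probability. -/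
def MDP.Communicating {S : Type u} {A : S → Type u} (M : MDP S A) : Prop :=
  ∀ s s' : S,
    Relation.ReflTransGen (fun t t' => ∃ x : Pair A, x.state = t ∧ M.trans x t' ≠ 0) s s'

/-- One interaction `(X_t, (R_t, S_{t+1}))`: the pair played, the reward received and the
next state. -/
abbrev Obs {S : Type u} (A : S → Type u) : Type u := Pair A × (ℝ × S)

/-- The histories before the `(n + 1)`-th decision: the initial state `S_1` followed by the
interactions `(X_t, (R_t, S_{t+1}))` for `t = 1, …, n`. -/
def Hist {S : Type u} (A : S → Type u) : ℕ → Type u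
  | 0 => S
  | n + 1 => Hist A n × Obs A

instance Hist.instMeasurableSpace {S : Type u} [MeasurableSpace S] (A : S → Type u) :
    (n : ℕ) → MeasurableSpace (Hist A n)
  | 0 => inferInstanceAs (MeasurableSpace S)
  | n + 1 =>
    letI := Hist.instMeasurableSpace A n
    inferInstanceAs (MeasurableSpace (Hist A n × Obs A))

/-- The current state `S_{n+1}` at the end of a history. -/
def Hist.cur {S : Type u} {A : S → Type u} : {n : ℕ} → Hist A n → S
  | 0, s => s
  | _ + 1, h => h.2.2.2

/-- The number of visits of the pair `x` among `X_1, …, X_n`. -/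
def Hist.visits {S : Type u} {A : S → Type u} (x : Pair A) : {n : ℕ} → Hist A n → ℕ
  | 0, _ => 0
  | _ + 1, h => Hist.visits x h.1 + (open Classical in if h.2.1 = x then 1 else 0)

/-- The cumulative reward `R_1 + ⋯ + R_n`. -/
def Hist.totalReward {S : Type u} {A : S → Type u} : {n : ℕ} → Hist A n → ℝ
  | 0, _ => 0
  | _ + 1, h => Hist.totalReward h.1 + h.2.2.1

theorem Hist.measurable_cur {S : Type u} [MeasurableSpace S] {A : S → Type u} :
    ∀ n : ℕ, Measurable (Hist.cur : Hist A n → S)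
  | 0 => measurable_id
  | n + 1 =>
    (measurable_snd.comp (measurable_snd.comp measurable_snd) :
      Measurable fun h : Hist A n × Obs A => h.2.2.2)

/-- A learning agent: after each history it chooses, possibly at random, an action that is
available in the current state. -/
structure Learner {S : Type u} [MeasurableSpace S] (A : S → Type u) where
  act : (n : ℕ) → Kernel (Hist A n) (Pair A)
  markov : ∀ n, IsMarkovKernel (act n)
  available : ∀ n (h : Hist A n), ∀ᵐ x ∂(act n h), x.state = h.cur

/-- A stationary (randomized) policy. -/
structure Policy {S : Type u} [MeasurableSpace S] (A : S → Type u) where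
  act : Kernel S (Pair A)
  markov : IsMarkovKernel act
  available : ∀ s : S, ∀ᵐ x ∂(act s), x.state = s

/-- A stationary policy, seen as a learning agent that only looks at the current state. -/
def Policy.toLearner {S : Type u} [MeasurableSpace S] {A : S → Type u} (π : Policy A) :
    Learner A where
  act n := π.act.comap Hist.cur (Hist.measurable_cur n)
  markov n :=
    haveI := π.markov
    Kernel.IsMarkovKernel.comap π.act (Hist.measurable_cur n)
  available n h := by
    rw [Kernel.comap_apply]
    exact π.available h.cur

/-- The response of the environment to a pair `x`: a reward drawn from `reward x` and,
independently, a next state drawn from `trans x`. -/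
def MDP.env {S : Type u} [MeasurableSpace S] {A : S → Type u} (M : MDP S A) :
    Kernel (Pair A) (ℝ × S) where
  toFun x := (M.reward x).prod (M.trans x).toMeasure
  measurable' := measurable_from_top

instance {S : Type u} [MeasurableSpace S] {A : S → Type u} (M : MDP S A) :
    IsMarkovKernel M.env where
  isProbabilityMeasure x := by
    haveI := M.reward_prob x
    exact inferInstanceAs (IsProbabilityMeasure ((M.reward x).prod (M.trans x).toMeasure))

/-- The law of the history of length `n` when the learner `L` interacts with `M` from the
initial state `s₀`. -/
def MDP.law {S : Type u} [MeasurableSpace S] {A : S → Type u} (M : MDP S A) (L : Learner A)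
    (s₀ : S) : (n : ℕ) → Measure (Hist A n)
  | 0 => (Measure.dirac s₀ : Measure S)
  | n + 1 => (M.law L s₀ n ⊗ₘ (L.act n ⊗ₖ M.env.prodMkLeft (Hist A n)) :
      Measure (Hist A n × Obs A))

instance instIsProbabilityMeasureLaw {S : Type u} [MeasurableSpace S] {A : S → Type u}
    (M : MDP S A) (L : Learner A) (s₀ : S) : (n : ℕ) → IsProbabilityMeasure (M.law L s₀ n)
  | 0 => inferInstanceAs (IsProbabilityMeasure (Measure.dirac s₀ : Measure S))
  | n + 1 => by
    haveI : IsProbabilityMeasure (M.law L s₀ n) :=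
      instIsProbabilityMeasureLaw M L s₀ n
    haveI := L.markov n
    exact inferInstanceAs (IsProbabilityMeasure
      (M.law L s₀ n ⊗ₘ (L.act n ⊗ₖ M.env.prodMkLeft (Hist A n)) : Measure (Hist A n × Obs A)))

/-- The expected number of visits of `x` during the first `T` steps. -/
def MDP.expVisits {S : Type u} [MeasurableSpace S] {A : S → Type u} (M : MDP S A)
    (L : Learner A) (s₀ : S) (x : Pair A) (T : ℕ) : ℝ :=
  ∫ h, (h.visits x : ℝ) ∂(M.law L s₀ T)

/-- The expected cumulative reward during the first `T` steps. -/
def MDP.expReward {S : Type u} [MeasurableSpace S] {A : S → Type u} (M : MDP S A)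
    (L : Learner A) (s₀ : S) (T : ℕ) : ℝ :=
  ∫ h, h.totalReward ∂(M.law L s₀ T)

/-- The gain (long-run average reward) of a stationary policy from the state `s`. With finitely
many states and actions the averages converge, so that the inferior limit is the limit. -/
def MDP.gain {S : Type u} [MeasurableSpace S] {A : S → Type u} (M : MDP S A) (π : Policy A)
    (s : S) : ℝ :=
  liminf (fun T : ℕ => M.expReward π.toLearner s T / T) atTop

/-- The optimal gain from the state `s`. -/
def MDP.optGain {S : Type u} [MeasurableSpace S] {A : S → Type u} (M : MDP S A) (s : S) : ℝ :=
  ⨆ π : Policy A, M.gain π s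

/-- A policy is gain-optimal if it achieves the optimal gain from every state. -/
def MDP.GainOptimal {S : Type u} [MeasurableSpace S] {A : S → Type u} (M : MDP S A)
    (π : Policy A) : Prop :=
  ∀ s, M.gain π s = M.optGain s

/-- `t'` is reached from `t` in one step with positive probability under the policy `π`. -/
def MDP.PolicyStep {S : Type u} [MeasurableSpace S] {A : S → Type u} (M : MDP S A)
    (π : Policy A) (t t' : S) : Prop :=
  ∃ x : Pair A, π.act t {x} ≠ 0 ∧ M.trans x t' ≠ 0

/-- The pair `x` is recurrent under `π`: `π` plays `x` with positive probability, and the state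
of `x` is recurrent in the finite Markov chain induced by `π`, i.e. it can be reached again from
every state that can be reached from it. -/
def MDP.IsRecurrentPair {S : Type u} [MeasurableSpace S] {A : S → Type u} (M : MDP S A)
    (π : Policy A) (x : Pair A) : Prop :=
  π.act x.state {x} ≠ 0 ∧
    ∀ s, Relation.ReflTransGen (M.PolicyStep π) x.state s →
      Relation.ReflTransGen (M.PolicyStep π) s x.state

/-- Optimal pairs: the pairs that are recurrent under some gain-optimal policy. -/
def MDP.IsOptimalPair {S : Type u} [MeasurableSpace S] {A : S → Type u} (M : MDP S A)
    (x : Pair A) : Prop :=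
  ∃ π : Policy A, M.GainOptimal π ∧ M.IsRecurrentPair π x

/-- The expected regret after `T` steps. -/
def MDP.regret {S : Type u} [MeasurableSpace S] {A : S → Type u} (M : MDP S A) (L : Learner A)
    (s₀ : S) (T : ℕ) : ℝ :=
  T * M.optGain s₀ - M.expReward L s₀ T

/-- A learner is consistent on a set of models if its regret is `o(T ^ η)` for every `η > 0`,
on every model of the set and from every initial state. -/
def Learner.Consistent {S : Type u} [MeasurableSpace S] {A : S → Type u} (L : Learner A)
    (models : Set (MDP S A)) : Prop :=
  ∀ M ∈ models, ∀ s₀ : S, ∀ η : ℝ, 0 < η →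
    (fun T : ℕ => M.regret L s₀ T) =o[atTop] (fun T : ℕ => (T : ℝ) ^ η)

/-- `M'` and `M` differ in, and only in, the reward distribution of `x`. -/
def MDP.DiffersOnlyInRewardAt {S : Type u} {A : S → Type u} (M M' : MDP S A) (x : Pair A) :
    Prop :=
  M'.trans = M.trans ∧ (∀ y, y ≠ x → M'.reward y = M.reward y) ∧ M.reward x ≠ M'.reward x

end CoExploration

end

/-!
Let `(g, φ)` solve the average-reward optimality equation of `M`: the gap
`g + φ(s) - r(s, a) - ∑ p(t | s, a) φ(t)` is nonnegative at every pair and vanishes at some pair of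
each state. Such a solution exists because `M` is communicating
(`exists_optimality_equation`, by letting the discount factor tend to `1`), and `g` is then at most
the optimal gain from every state. Let `M'` be a model that differs from `M` only by a larger mean
reward at `x`, and let `(g', φ')` solve its optimality equation. A gain-optimal policy of `M` under
which `x` is recurrent visits `x` at a positive rate
(`MDP.IsRecurrentPair.exists_le_expVisits`), so that it gains more in `M'`, and `g < g'`
(`MDP.OptimalityEquation.gain_lt`).

The expected sum of the gaps of `M'` is, up to a constant, the regret on `M'`. Since the gaps of `M`
are nonnegative, the gaps of `M'` along a history of length `T` add up to at least
`T (g' - g) - (r'(x) - r(x)) N(x)`, up to a constant and a martingale with bounded increments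
(`MDP.DiffersOnlyInRewardAt.ae_le_obsSum_gap`). On the event that `x` is visited less than `a T`
times, either this sum or the martingale is of order `T`; the regret is `o(√T)` and the second
moment of the martingale is `O(T)`, hence this event has probability `O(1 / √T)` under `M'`
(`MDP.DiffersOnlyInRewardAt.exists_measure_few_visits_le`).

If the expected number of visits under `M` were less than `K log T`, then by Markov's inequality the
same event would have probability at least `1 / 2` under `M`. Distinguishing the two models in this
way takes a relative entropy of at least `(log T) / 4 - O(1)` (`EntropyBound.log_le`), whereas the
relative entropy of the two laws of the history is at most the expected number of visits of `x`
times the relative entropy of the two reward distributions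
(`MDP.DiffersOnlyInRewardAt.entropyBound_law`), that is at most `(log T) / 8` once the latter is at
most `1 / (8 K)`.

Relative entropy is only used through the Donsker–Varadhan inequality (`EntropyBound`), for which
the chain rule along the interaction follows by applying the inequality conditionally on the past.
-/

namespace CoExploration

/-! ### The average-reward optimality equation of a communicating model -/

theorem exists_abs_le {α : Type*} [Finite α] (φ : α → ℝ) : ∃ H, ∀ a, |φ a| ≤ H := by
  obtain ⟨H, hH⟩ := (Set.finite_range fun a => |φ a|).bddAbove
  exact ⟨H, fun a => hH ⟨a, rfl⟩⟩

/-- `v` solves the optimality equation with discount factor `β` of the decision process with pairs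
`X`, transition probabilities `P` and mean rewards `r`, where `st x` is the state of the pair `x`.
The maximum over the pairs of a state is written as an upper bound that is attained. -/
def IsDiscountedValue {S X : Type*} [Fintype S] (st : X → S) (P : X → S → ℝ) (r : X → ℝ) (β : ℝ)
    (v : S → ℝ) : Prop :=
  (∀ x, r x + β * ∑ s, P x s * v s ≤ v (st x)) ∧
    ∀ s, ∃ x, st x = s ∧ v s = r x + β * ∑ t, P x t * v t

/-- Value iteration with discount factor `β < 1` has a fixed point. -/
theorem exists_discounted_value {S X : Type*} [Fintype S] [Finite X] (st : X → S)
    (hst : Function.Surjective st) (P : X → S → ℝ) (hP0 : ∀ x s, 0 ≤ P x s)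
    (hP1 : ∀ x, ∑ s, P x s = 1) (r : X → ℝ) (β : ℝ) (h0 : 0 ≤ β) (h1 : β < 1) :
    ∃ v : S → ℝ, IsDiscountedValue st P r β v := by
  have hne : ∀ s, Nonempty {x // st x = s} := fun s => ⟨⟨_, (hst s).choose_spec⟩⟩
  let Q : (S → ℝ) → X → ℝ := fun v x => r x + β * ∑ s, P x s * v s
  let B : (S → ℝ) → S → ℝ := fun v s => ⨆ x : {x // st x = s}, Q v x.1
  have hle : ∀ v x, Q v x ≤ B v (st x) := fun v x =>
    le_ciSup (f := fun y : {y // st y = st x} => Q v y.1) (Set.finite_range _).bddAbove ⟨x, rfl⟩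
  have heq : ∀ v s, ∃ x, st x = s ∧ B v s = Q v x := by
    intro v s
    obtain ⟨y, hy⟩ := exists_eq_ciSup_of_finite (f := fun y : {y // st y = s} => Q v y.1)
    exact ⟨y.1, y.2, hy.symm⟩
  have hQ : ∀ v w x, Q v x ≤ Q w x + β * dist v w := by
    intro v w x
    have : ∑ s, P x s * v s ≤ ∑ s, P x s * w s + dist v w := by
      calc ∑ s, P x s * v s ≤ ∑ s, (P x s * w s + P x s * dist v w) := by
            refine Finset.sum_le_sum fun s _ => ?_
            have h2 : v s - w s ≤ dist v w :=
              (le_abs_self _).trans ((Real.dist_eq _ _).symm.le.trans (dist_le_pi_dist v w s))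
            nlinarith [hP0 x s]
        _ = _ := by rw [Finset.sum_add_distrib, ← Finset.sum_mul, hP1, one_mul]
    simp only [Q]
    nlinarith
  have hB : ∀ v w s, B v s ≤ B w s + β * dist v w := by
    intro v w s
    obtain ⟨x, rfl, hx⟩ := heq v s
    rw [hx]
    linarith [hQ v w x, hle w x]
  have hc : ContractingWith ⟨β, h0⟩ B := by
    refine ⟨by exact_mod_cast h1, LipschitzWith.of_dist_le_mul fun v w => ?_⟩
    refine (dist_pi_le_iff (mul_nonneg h0 dist_nonneg)).2 fun s => ?_
    rw [Real.dist_eq, abs_le]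
    have h2 := hB v w s
    have h3 := hB w v s
    rw [dist_comm w v] at h3
    change _ ≤ _ ∧ _ ≤ β * dist v w
    constructor
    · change -(β * dist v w) ≤ _
      linarith
    · linarith
  have hfix : B hc.fixedPoint = hc.fixedPoint := hc.fixedPoint_isFixedPt
  refine ⟨hc.fixedPoint, fun x => ?_, fun s => ?_⟩
  · have := hle hc.fixedPoint x
    rwa [hfix] at this
  · obtain ⟨x, hx, h⟩ := heq hc.fixedPoint s
    rw [hfix] at h
    exact ⟨x, hx, h⟩

/-- The span of the discounted value function of a communicating model is bounded uniformly in the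
discount factor: the deficit of a state with respect to the largest value is controlled along a
path leading to a state of largest value. -/
theorem exists_discounted_span_bound {S X : Type*} [Fintype S] [Nonempty S] [Finite X] (st : X → S)
    (P : X → S → ℝ) (hP0 : ∀ x s, 0 ≤ P x s)
    (hP1 : ∀ x, ∑ s, P x s = 1) (r : X → ℝ)
    (hcomm : ∀ s s', Relation.ReflTransGen (fun t t' => ∃ x, st x = t ∧ P x t' ≠ 0) s s') :
    ∃ K : ℝ, ∀ (β : ℝ) (v : S → ℝ), 0 ≤ β → β < 1 → IsDiscountedValue st P r β v →
      ∀ s t, v s - v t ≤ K := by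
  obtain ⟨R, hR⟩ := exists_abs_le r
  have key : ∀ s' s, ∃ K : ℝ, ∀ (β : ℝ) (v : S → ℝ), 0 ≤ β → β < 1 →
      IsDiscountedValue st P r β v →
      (∀ t, v t ≤ v s') → (∀ t, v s ≤ v t) → v s' - v s ≤ K := by
    intro s' s
    -- `v t - v s` dominates a fixed fraction of the span, up to a constant, when `t` leads to `s'`
    have : ∀ t, Relation.ReflTransGen (fun t t' => ∃ x, st x = t ∧ P x t' ≠ 0) t s' →
        ∃ c C : ℝ, 0 < c ∧ ∀ (β : ℝ) (v : S → ℝ), 0 ≤ β → β < 1 →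
          IsDiscountedValue st P r β v →
          (∀ t, v t ≤ v s') → (∀ t, v s ≤ v t) → c * (v s' - v s) - C ≤ v t - v s := by
      intro t ht
      induction ht using Relation.ReflTransGen.head_induction_on with
      | refl => exact ⟨1, 0, one_pos, fun β v _ _ _ _ _ => by linarith⟩
      | head hab _ ih =>
        rename_i _ b _
        obtain ⟨c, C, hc, ih⟩ := ih
        obtain ⟨x, rfl, hx⟩ := hab
        have hpos : 0 < P x b := lt_of_le_of_ne (hP0 x b) (Ne.symm hx)
        refine ⟨P x b * c, P x b * C + 2 * R, by positivity, fun β v h0 h1 hv hmax hmin => ?_⟩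
        have ih := ih β v h0 h1 hv hmax hmin
        have h2 : P x b * (v b - v s) ≤ ∑ u, P x u * (v u - v s) :=
          Finset.single_le_sum (f := fun u => P x u * (v u - v s))
            (fun u _ => mul_nonneg (hP0 x u) (by linarith [hmin u])) (Finset.mem_univ b)
        have h3 : ∑ u, P x u * (v u - v s) = ∑ u, P x u * v u - v s := by
          simp only [mul_sub, Finset.sum_sub_distrib, ← Finset.sum_mul, hP1, one_mul]
        have h4 := hv.1 x
        have h5 := (abs_le.1 (hR x)).1
        -- the largest value is at most `R / (1 - β)`
        have h6 : (1 - β) * v s' ≤ R := by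
          obtain ⟨y, -, hy⟩ := hv.2 s'
          have : ∑ u, P y u * v u ≤ v s' := by
            calc ∑ u, P y u * v u ≤ ∑ u, P y u * v s' :=
                  Finset.sum_le_sum fun u _ => mul_le_mul_of_nonneg_left (hmax u) (hP0 y u)
              _ = _ := by rw [← Finset.sum_mul, hP1, one_mul]
          nlinarith [(abs_le.1 (hR y)).2]
        have h7 : ∑ u, P x u * v u ≤ v s' := by
          calc ∑ u, P x u * v u ≤ ∑ u, P x u * v s' :=
                Finset.sum_le_sum fun u _ => mul_le_mul_of_nonneg_left (hmax u) (hP0 x u)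
            _ = _ := by rw [← Finset.sum_mul, hP1, one_mul]
        nlinarith [mul_le_mul_of_nonneg_left ih hpos.le]
    obtain ⟨c, C, hc, h⟩ := this s (hcomm s s')
    refine ⟨C / c, fun β v h0 h1 hv hmax hmin => ?_⟩
    rw [le_div_iff₀ hc]
    linarith [h β v h0 h1 hv hmax hmin]
  choose K hK using key
  obtain ⟨K', hK'⟩ := (Set.finite_range fun p : S × S => K p.1 p.2).bddAbove
  refine ⟨K', fun β v h0 h1 hv s t => ?_⟩
  obtain ⟨a, ha⟩ := Finite.exists_max v
  obtain ⟨b, hb⟩ := Finite.exists_min v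
  linarith [hK a b β v h0 h1 hv ha hb, hK' ⟨(a, b), rfl⟩, ha s, hb t]

/-- The average-reward optimality equation has a solution `(g, h)` in a communicating model: it is
a limit point of the normalised discounted value functions as the discount factor tends to `1`. -/
theorem exists_optimality_equation {S X : Type*} [Fintype S] [Nonempty S] [Finite X] (st : X → S)
    (hst : Function.Surjective st) (P : X → S → ℝ) (hP0 : ∀ x s, 0 ≤ P x s)
    (hP1 : ∀ x, ∑ s, P x s = 1) (r : X → ℝ)
    (hcomm : ∀ s s', Relation.ReflTransGen (fun t t' => ∃ x, st x = t ∧ P x t' ≠ 0) s s') :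
    ∃ (g : ℝ) (h : S → ℝ), (∀ x, r x + ∑ s, P x s * h s ≤ g + h (st x)) ∧
      ∀ s, ∃ x, st x = s ∧ g + h s ≤ r x + ∑ t, P x t * h t := by
  obtain ⟨K, hK⟩ := exists_discounted_span_bound st P hP0 hP1 r hcomm
  obtain ⟨R, hR⟩ := exists_abs_le r
  let β : ℕ → ℝ := fun n => 1 - 1 / ((n : ℝ) + 1)
  have hβ0 : ∀ n, 0 ≤ β n := by
    intro n
    have : 1 / ((n : ℝ) + 1) ≤ 1 := by
      rw [div_le_one (by positivity)]
      linarith [Nat.cast_nonneg (α := ℝ) n]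
    simp only [β]; linarith
  have hβ1 : ∀ n, β n < 1 := by
    intro n
    have : 0 < 1 / ((n : ℝ) + 1) := by positivity
    simp only [β]; linarith
  have hβ : Tendsto β atTop (nhds 1) := by
    simpa [β] using tendsto_one_div_add_atTop_nhds_zero_nat (𝕜 := ℝ) |>.const_sub 1
  choose v hv using fun n =>
    exists_discounted_value st hst P hP0 hP1 r (β n) (hβ0 n) (hβ1 n)
  obtain ⟨s₀⟩ := ‹Nonempty S›
  let w : ℕ → ℝ × (S → ℝ) := fun n => ((1 - β n) * v n s₀, fun s => v n s - v n s₀)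
  have hsum : ∀ n x, ∑ s, P x s * (w n).2 s = ∑ s, P x s * v n s - v n s₀ := by
    intro n x
    simp only [w, mul_sub, Finset.sum_sub_distrib, ← Finset.sum_mul, hP1, one_mul]
  have hw1 : ∀ n x, r x + β n * ∑ s, P x s * (w n).2 s ≤ (w n).1 + (w n).2 (st x) := by
    intro n x
    rw [hsum]
    simp only [w]
    linarith [(hv n).1 x]
  have hw2 : ∀ n s, ∃ x, st x = s ∧ (w n).1 + (w n).2 s = r x + β n * ∑ t, P x t * (w n).2 t := by
    intro n s
    obtain ⟨x, hx, h⟩ := (hv n).2 s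
    refine ⟨x, hx, ?_⟩
    rw [hsum]
    simp only [w]
    linarith
  have hK0 : 0 ≤ K := by
    have := hK (β 0) (v 0) (hβ0 0) (hβ1 0) (hv 0) s₀ s₀
    linarith
  have hwK : ∀ n s, |(w n).2 s| ≤ K := by
    intro n s
    rw [abs_le]
    have h1 := hK (β n) (v n) (hβ0 n) (hβ1 n) (hv n) s s₀
    have h2 := hK (β n) (v n) (hβ0 n) (hβ1 n) (hv n) s₀ s
    simp only [w]
    constructor <;> linarith
  have hwP : ∀ n x, |∑ s, P x s * (w n).2 s| ≤ K := by
    intro n x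
    calc |∑ s, P x s * (w n).2 s| ≤ ∑ s, |P x s * (w n).2 s| := Finset.abs_sum_le_sum_abs _ _
      _ ≤ ∑ s, P x s * K := by
        refine Finset.sum_le_sum fun s _ => ?_
        rw [abs_mul, abs_of_nonneg (hP0 x s)]
        exact mul_le_mul_of_nonneg_left (hwK n s) (hP0 x s)
      _ = K := by rw [← Finset.sum_mul, hP1, one_mul]
  have hwg : ∀ n, |(w n).1| ≤ R + K := by
    intro n
    obtain ⟨x, -, hx⟩ := hw2 n s₀
    have h0 : (w n).2 s₀ = 0 := by simp [w]
    have h1 : |β n * ∑ t, P x t * (w n).2 t| ≤ K := by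
      rw [abs_mul, abs_of_nonneg (hβ0 n)]
      nlinarith [hwP n x, abs_nonneg (∑ t, P x t * (w n).2 t), hβ1 n, hβ0 n]
    rw [h0, add_zero] at hx
    rw [hx]
    exact (abs_add_le _ _).trans (add_le_add (hR x) h1)
  have hbdd : Bornology.IsBounded (Metric.closedBall (0 : ℝ × (S → ℝ)) (max (R + K) K)) :=
    Metric.isBounded_closedBall
  obtain ⟨⟨g, h⟩, -, φ, hφ, hlim⟩ := tendsto_subseq_of_bounded hbdd (x := w) fun n => by
    rw [mem_closedBall_zero_iff]
    refine max_le_max (hwg n) ?_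
    rw [pi_norm_le_iff_of_nonneg hK0]
    exact fun s => hwK n s
  have hg : Tendsto (fun n => (w (φ n)).1) atTop (nhds g) := (continuous_fst.tendsto _).comp hlim
  have hh : ∀ s, Tendsto (fun n => (w (φ n)).2 s) atTop (nhds (h s)) := fun s =>
    (((continuous_apply s).comp continuous_snd).tendsto (g, h)).comp hlim
  have hrhs : ∀ x, Tendsto (fun n => r x + β (φ n) * ∑ s, P x s * (w (φ n)).2 s) atTop
      (nhds (r x + ∑ s, P x s * h s)) := by
    intro x
    have h1 := tendsto_finsetSum Finset.univ fun s _ => (hh s).const_mul (P x s)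
    simpa using ((hβ.comp hφ.tendsto_atTop).mul h1).const_add (r x)
  refine ⟨g, h, fun x => ?_, fun s => ?_⟩
  · exact le_of_tendsto_of_tendsto' (hrhs x) (hg.add (hh (st x))) fun n => hw1 (φ n) x
  · by_contra! hcon
    -- strict inequalities at the finitely many pairs of `s` would hold before the limit
    have : ∀ᶠ n in atTop, ∀ x, st x = s →
        r x + β (φ n) * ∑ t, P x t * (w (φ n)).2 t < (w (φ n)).1 + (w (φ n)).2 s := by
      rw [eventually_all]
      intro x
      by_cases hx : st x = s
      · filter_upwards [(hrhs x).eventually_lt (hg.add (hh s)) (hcon x hx)] with n hn _ using hn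
      · exact Eventually.of_forall fun n h => absurd h hx
    obtain ⟨n, hn⟩ := this.exists
    obtain ⟨x, hx, h⟩ := hw2 (φ n) s
    exact absurd h (hn x hx).ne'

/-! ### Relative entropy through the variational inequality -/

/-- The relative entropy of `μ` with respect to `ν` is at most `D`, in the dual form of the
Donsker–Varadhan formula. In this form the chain rule for composition-products is immediate. -/
def EntropyBound {α : Type*} [MeasurableSpace α] (μ ν : Measure α) (D : ℝ) : Prop :=
  ∀ f : α → ℝ, Measurable f → (∃ C, ∀ a, |f a| ≤ C) →
    ∫ a, f a ∂μ ≤ D + Real.log (∫ a, Real.exp (f a) ∂ν)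

theorem integrable_of_abs_le {α : Type*} [MeasurableSpace α] {μ : Measure α} [IsFiniteMeasure μ]
    {f : α → ℝ} (hf : Measurable f) {C : ℝ} (hC : ∀ a, |f a| ≤ C) : Integrable f μ :=
  Integrable.of_bound hf.aestronglyMeasurable C (Eventually.of_forall hC)

theorem abs_integral_le_of_abs_le {α : Type*} [MeasurableSpace α] {μ : Measure α}
    [IsProbabilityMeasure μ] {f : α → ℝ} {C : ℝ} (hC : ∀ a, |f a| ≤ C) : |∫ a, f a ∂μ| ≤ C := by
  simpa using norm_integral_le_of_norm_le_const (μ := μ) (f := f) (Eventually.of_forall hC)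

theorem entropyBound_of_klDiv_ne_top {α : Type*} [MeasurableSpace α] {μ ν : Measure α}
    [IsProbabilityMeasure μ] [IsProbabilityMeasure ν] (h : InformationTheory.klDiv μ ν ≠ ⊤) :
    EntropyBound μ ν (InformationTheory.klDiv μ ν).toReal := by
  rintro f hf ⟨C, hC⟩
  obtain ⟨hac, hint⟩ := InformationTheory.klDiv_ne_top_iff.1 h
  have hfμ : Integrable f μ := integrable_of_abs_le hf hC
  have hfν : Integrable (fun a => Real.exp (f a)) ν :=
    integrable_of_abs_le (C := Real.exp C) (Real.measurable_exp.comp hf) fun a => by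
      rw [abs_of_pos (Real.exp_pos _)]
      exact Real.exp_le_exp.2 ((le_abs_self _).trans (hC a))
  have : IsProbabilityMeasure (ν.tilted f) := isProbabilityMeasure_tilted hfν
  -- nonnegativity of the relative entropy with respect to the measure `ν` tilted by `f`
  have h1 := InformationTheory.integral_llr_add_sub_measure_univ_nonneg
    (hac.trans (absolutelyContinuous_tilted hfν))
    (integrable_llr_tilted_right hac hfμ hint hfν)
  rw [integral_llr_tilted_right hac hfμ hfν hint] at h1
  rw [InformationTheory.toReal_klDiv_of_measure_eq hac (by simp)]
  simp only [probReal_univ] at h1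
  linarith

theorem entropyBound_self {α : Type*} [MeasurableSpace α] (μ : Measure α)
    [IsProbabilityMeasure μ] : EntropyBound μ μ 0 := by
  simpa using entropyBound_of_klDiv_ne_top (μ := μ) (ν := μ) (by simp)

theorem EntropyBound.compProd {α β : Type*} [MeasurableSpace α] [MeasurableSpace β]
    {μ ν : Measure α} [IsProbabilityMeasure μ] [IsProbabilityMeasure ν]
    {κ η : Kernel α β} [IsMarkovKernel κ] [IsMarkovKernel η] {D : ℝ} {d : α → ℝ}
    (h : EntropyBound μ ν D) (hd : Integrable d μ)
    (hκ : ∀ a, EntropyBound (κ a) (η a) (d a)) :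
    EntropyBound (μ ⊗ₘ κ) (ν ⊗ₘ η) (D + ∫ a, d a ∂μ) := by
  rintro f hf ⟨C, hC⟩
  have hexp : ∀ p, |Real.exp (f p)| ≤ Real.exp C := fun p => by
    rw [abs_of_pos (Real.exp_pos _)]
    exact Real.exp_le_exp.2 ((le_abs_self _).trans (hC p))
  have hexpm : Measurable fun p => Real.exp (f p) := Real.measurable_exp.comp hf
  have hlow : ∀ a, Real.exp (-C) ≤ ∫ b, Real.exp (f (a, b)) ∂η a := fun a => by
    have := integral_mono (μ := η a) (integrable_const (Real.exp (-C)))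
      (integrable_of_abs_le (hexpm.comp measurable_prodMk_left) fun b => hexp (a, b)) fun b =>
        Real.exp_le_exp.2 (neg_le_of_abs_le (hC (a, b)))
    simpa using this
  have hup : ∀ a, ∫ b, Real.exp (f (a, b)) ∂η a ≤ Real.exp C := fun a =>
    (le_abs_self _).trans (abs_integral_le_of_abs_le fun b => hexp (a, b))
  have hpos : ∀ a, 0 < ∫ b, Real.exp (f (a, b)) ∂η a := fun a => (Real.exp_pos _).trans_le (hlow a)
  have hm : Measurable fun a => ∫ b, Real.exp (f (a, b)) ∂η a :=
    (hexpm.stronglyMeasurable.integral_kernel_prod_right' (κ := η)).measurable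
  have hg : Measurable fun a => Real.log (∫ b, Real.exp (f (a, b)) ∂η a) :=
    Real.measurable_log.comp hm
  have hgC : ∀ a, |Real.log (∫ b, Real.exp (f (a, b)) ∂η a)| ≤ C := fun a => by
    rw [abs_le]
    constructor
    · exact (Real.le_log_iff_exp_le (hpos a)).2 (hlow a)
    · exact (Real.log_le_iff_le_exp (hpos a)).2 (hup a)
  have hfm : Measurable fun a => ∫ b, f (a, b) ∂κ a :=
    (hf.stronglyMeasurable.integral_kernel_prod_right' (κ := κ)).measurable
  -- the inequality for `μ`, `ν` at the conditional log-moment generating function of `f`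
  have h1 := h _ hg ⟨C, hgC⟩
  simp only [Real.exp_log (hpos _)] at h1
  rw [Measure.integral_compProd (integrable_of_abs_le hf hC),
    Measure.integral_compProd (integrable_of_abs_le hexpm hexp)]
  have hgi : Integrable (fun a => Real.log (∫ b, Real.exp (f (a, b)) ∂η a)) μ :=
    integrable_of_abs_le hg hgC
  have h2 : ∫ a, ∫ b, f (a, b) ∂κ a ∂μ
      ≤ ∫ a, (d a + Real.log (∫ b, Real.exp (f (a, b)) ∂η a)) ∂μ :=
    integral_mono (integrable_of_abs_le hfm fun a => abs_integral_le_of_abs_le fun b => hC (a, b))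
      (hd.add hgi) fun a => hκ a _ (hf.comp measurable_prodMk_left) ⟨C, fun b => hC (a, b)⟩
  rw [integral_add hd hgi] at h2
  linarith

/-- A set that is likely for `μ` and has probability at most `c / √T` for `ν` forces a relative
entropy of the order of `log T`. -/
theorem EntropyBound.log_le {α : Type*} [MeasurableSpace α] {μ ν : Measure α}
    [IsProbabilityMeasure μ] [IsProbabilityMeasure ν] {D : ℝ} (h : EntropyBound μ ν D)
    {E : Set α} (hE : MeasurableSet E) {T c : ℝ} (hT : 1 ≤ T) (hμ : 1 / 2 ≤ μ.real E)
    (hν : ν.real E * Real.sqrt T ≤ c) : Real.log T / 4 ≤ D + Real.log (1 + c) := by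
  have hlog : 0 ≤ Real.log T := Real.log_nonneg hT
  have hsq : Real.exp (Real.log T / 2) = Real.sqrt T := by
    rw [Real.sqrt_eq_rpow, Real.rpow_def_of_pos (by linarith)]
    ring_nf
  have hc : 0 ≤ c := le_trans (by positivity) hν
  -- the test function `(log T / 2) 1_E`, whose exponential is `√T` on `E`
  have h1 := h (E.indicator fun _ => Real.log T / 2) (measurable_const.indicator hE)
    ⟨Real.log T / 2, fun a => by
      by_cases ha : a ∈ E
      · simp [ha, abs_div, abs_of_nonneg hlog]
      · simp only [Set.indicator_of_notMem ha, abs_zero]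
        linarith⟩
  rw [integral_indicator_const _ hE, smul_eq_mul] at h1
  have h2 : ∫ a, Real.exp (E.indicator (fun _ => Real.log T / 2) a) ∂ν ≤ 1 + c := by
    have h3 : ∀ a, Real.exp (E.indicator (fun _ => Real.log T / 2) a)
        ≤ 1 + E.indicator (fun _ => Real.sqrt T) a := fun a => by
      by_cases ha : a ∈ E <;> simp [ha, hsq]
    calc _ ≤ ∫ a, (1 + E.indicator (fun _ => Real.sqrt T) a) ∂ν := by
          refine integral_mono_of_nonneg (Eventually.of_forall fun a => (Real.exp_pos _).le) ?_
            (Eventually.of_forall h3)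
          exact (integrable_const _).add ((integrable_const _).indicator hE)
      _ = 1 + ν.real E * Real.sqrt T := by
          rw [integral_add (integrable_const _) ((integrable_const _).indicator hE),
            integral_indicator_const _ hE]
          simp
      _ ≤ 1 + c := by linarith
  have h4 : Real.log (∫ a, Real.exp (E.indicator (fun _ => Real.log T / 2) a) ∂ν)
      ≤ Real.log (1 + c) := by
    have hnn : 0 ≤ ∫ a, Real.exp (E.indicator (fun _ => Real.log T / 2) a) ∂ν :=
      integral_nonneg fun a => (Real.exp_pos _).le
    rcases hnn.eq_or_lt with h0 | h0
    · rw [← h0, Real.log_zero]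
      exact Real.log_nonneg (by linarith)
    · exact Real.log_le_log h0 h2
  nlinarith

/-! ### Additive functionals of the history -/

section

variable {S : Type u} {A : S → Type u}

instance [Finite S] [∀ s, Finite (A s)] : Finite (Pair A) := inferInstanceAs (Finite (Σ s, A s))

/-- The sum of `F (X_t, R_t, S_{t+1})` over the interactions of a history. -/
noncomputable def Hist.obsSum (F : Obs A → ℝ) : {n : ℕ} → Hist A n → ℝ
  | 0, _ => 0
  | _ + 1, h => Hist.obsSum F h.1 + F h.2

theorem Hist.abs_obsSum_le {F : Obs A → ℝ} {B : ℝ} (hF : ∀ o, |F o| ≤ B) :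
    ∀ {n : ℕ} (h : Hist A n), |Hist.obsSum F h| ≤ n * B
  | 0, _ => by simp [Hist.obsSum]
  | n + 1, h => by
    have h1 := Hist.abs_obsSum_le hF h.1
    push_cast
    rw [add_mul, one_mul]
    exact (abs_add_le _ _).trans (add_le_add h1 (hF h.2))

theorem Hist.obsSum_add (F G : Obs A → ℝ) :
    ∀ {n : ℕ} (h : Hist A n), Hist.obsSum (fun o => F o + G o) h = Hist.obsSum F h + Hist.obsSum G h
  | 0, _ => by simp [Hist.obsSum]
  | n + 1, h => by
    simp only [Hist.obsSum, Hist.obsSum_add F G h.1]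
    ring

theorem Hist.obsSum_const_mul (c : ℝ) (F : Obs A → ℝ) :
    ∀ {n : ℕ} (h : Hist A n), Hist.obsSum (fun o => c * F o) h = c * Hist.obsSum F h
  | 0, _ => by simp [Hist.obsSum]
  | n + 1, h => by
    simp only [Hist.obsSum, Hist.obsSum_const_mul c F h.1]
    ring

theorem Hist.obsSum_sub (F G : Obs A → ℝ) {n : ℕ} (h : Hist A n) :
    Hist.obsSum (fun o => F o - G o) h = Hist.obsSum F h - Hist.obsSum G h := by
  have := Hist.obsSum_add F (fun o => -1 * G o) h
  rw [Hist.obsSum_const_mul] at this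
  simpa [sub_eq_add_neg] using this

theorem Hist.obsSum_const (c : ℝ) : ∀ {n : ℕ} (h : Hist A n), Hist.obsSum (fun _ => c) h = n * c
  | 0, _ => by simp [Hist.obsSum]
  | n + 1, h => by
    simp only [Hist.obsSum, Hist.obsSum_const c h.1]
    push_cast
    ring

theorem Hist.obsSum_mono {F G : Obs A → ℝ} (hFG : ∀ o, F o ≤ G o) :
    ∀ {n : ℕ} (h : Hist A n), Hist.obsSum F h ≤ Hist.obsSum G h
  | 0, _ => le_rfl
  | _ + 1, h => add_le_add (Hist.obsSum_mono hFG h.1) (hFG h.2)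

open Classical in
theorem Hist.visits_eq_obsSum (x : Pair A) :
    ∀ {n : ℕ} (h : Hist A n), (h.visits x : ℝ) = Hist.obsSum (fun o => if o.1 = x then 1 else 0) h
  | 0, _ => by simp [Hist.obsSum, Hist.visits]
  | n + 1, h => by
    simp only [Hist.obsSum, Hist.visits, ← Hist.visits_eq_obsSum x h.1]
    push_cast
    rfl

theorem Hist.totalReward_eq_obsSum :
    ∀ {n : ℕ} (h : Hist A n), h.totalReward = Hist.obsSum (fun o => o.2.1) h
  | 0, _ => by simp [Hist.obsSum, Hist.totalReward]
  | n + 1, h => by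
    simp only [Hist.obsSum, Hist.totalReward, ← Hist.totalReward_eq_obsSum h.1]

variable [MeasurableSpace S]

theorem measurable_obs_fst (k : Pair A → ℝ) : Measurable fun o : Obs A => k o.1 :=
  (Measurable.of_discrete (f := k)).comp measurable_fst

instance (L : Learner A) (n : ℕ) : IsMarkovKernel (L.act n) := L.markov n

instance (M : MDP S A) (y : Pair A) : IsProbabilityMeasure (M.reward y) := M.reward_prob y

instance (π : Policy A) : IsMarkovKernel π.act := π.markov

theorem Hist.measurable_obsSum {F : Obs A → ℝ} (hF : Measurable F) :
    ∀ n, Measurable (Hist.obsSum F : Hist A n → ℝ)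
  | 0 => measurable_const
  | n + 1 =>
    (((Hist.measurable_obsSum hF n).comp measurable_fst).add (hF.comp measurable_snd) :
      Measurable fun h : Hist A n × Obs A => Hist.obsSum F h.1 + F h.2)

/-- The law of one interaction, given the history. -/
noncomputable def MDP.stepKernel (M : MDP S A) (L : Learner A) (n : ℕ) :
    Kernel (Hist A n) (Obs A) :=
  L.act n ⊗ₖ M.env.prodMkLeft (Hist A n)

instance (M : MDP S A) (L : Learner A) (n : ℕ) : IsMarkovKernel (M.stepKernel L n) :=
  inferInstanceAs (IsMarkovKernel (L.act n ⊗ₖ M.env.prodMkLeft (Hist A n)))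

theorem MDP.stepKernel_apply (M : MDP S A) (L : Learner A) (n : ℕ) (h : Hist A n) :
    M.stepKernel L n h = L.act n h ⊗ₘ M.env := by
  rw [MDP.stepKernel, Kernel.compProd_apply_eq_compProd_sectR]
  rfl

theorem MDP.law_succ (M : MDP S A) (L : Learner A) (s₀ : S) (n : ℕ) :
    M.law L s₀ (n + 1) = (M.law L s₀ n ⊗ₘ M.stepKernel L n : Measure (Hist A n × Obs A)) := rfl

/-- The conditional mean of `F (X_t, R_t, S_{t+1})` given `X_t = y`. -/
noncomputable def MDP.obsMean (M : MDP S A) (F : Obs A → ℝ) (y : Pair A) : ℝ :=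
  ∫ z, F (y, z) ∂(M.env y)

theorem MDP.measurePreserving_fst (M : MDP S A) (L : Learner A) (s₀ : S) (n : ℕ) :
    MeasurePreserving (fun h : Hist A n × Obs A => h.1)
      (M.law L s₀ n ⊗ₘ M.stepKernel L n) (M.law L s₀ n) :=
  ⟨measurable_fst, Measure.fst_compProd _ _⟩

theorem MDP.integral_comp_fst (M : MDP S A) (L : Learner A) (s₀ : S) (n : ℕ) {f : Hist A n → ℝ}
    (hf : Measurable f) :
    ∫ h, f h.1 ∂(M.law L s₀ n ⊗ₘ M.stepKernel L n) = ∫ h, f h ∂(M.law L s₀ n) := by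
  have hmp := M.measurePreserving_fst L s₀ n
  have := integral_map (μ := M.law L s₀ n ⊗ₘ M.stepKernel L n) hmp.measurable.aemeasurable
    (f := f) hf.aestronglyMeasurable
  rw [hmp.map_eq] at this
  exact this.symm

theorem MDP.ae_law_succ (M : MDP S A) (L : Learner A) (s₀ : S) (n : ℕ)
    {p : Hist A n × Obs A → Prop} (hp : MeasurableSet {h | p h})
    (h : ∀ᵐ h ∂(M.law L s₀ n), ∀ᵐ y ∂(L.act n h), ∀ᵐ z ∂(M.env y), p (h, (y, z))) :
    ∀ᵐ h ∂(M.law L s₀ (n + 1)), p h := by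
  rw [M.law_succ]
  refine Measure.ae_compProd_of_ae_ae hp ?_
  filter_upwards [h] with a ha
  rw [M.stepKernel_apply]
  exact Measure.ae_compProd_of_ae_ae (hp.preimage measurable_prodMk_left) ha

section Finite

variable [Finite (Pair A)] (M : MDP S A) (L : Learner A) (s₀ : S)

theorem MDP.integrable_stepKernel {F : Obs A → ℝ} (hF : Measurable F)
    (hFi : ∀ y, Integrable (fun z => F (y, z)) (M.env y)) (n : ℕ) (h : Hist A n) :
    Integrable F (M.stepKernel L n h) := by
  rw [M.stepKernel_apply, Measure.integrable_compProd_iff hF.aestronglyMeasurable]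
  exact ⟨Eventually.of_forall hFi, .of_finite⟩

theorem MDP.integral_stepKernel {F : Obs A → ℝ} (hF : Measurable F)
    (hFi : ∀ y, Integrable (fun z => F (y, z)) (M.env y)) (n : ℕ) (h : Hist A n) :
    ∫ o, F o ∂(M.stepKernel L n h) = ∫ y, M.obsMean F y ∂(L.act n h) := by
  have := M.integrable_stepKernel L hF hFi n h
  rw [M.stepKernel_apply] at this ⊢
  rw [Measure.integral_compProd this]
  rfl

theorem MDP.integrable_snd {F : Obs A → ℝ} (hF : Measurable F)
    (hFi : ∀ y, Integrable (fun z => F (y, z)) (M.env y)) (n : ℕ) :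
    Integrable (fun h : Hist A n × Obs A => F h.2) (M.law L s₀ n ⊗ₘ M.stepKernel L n) := by
  rw [Measure.integrable_compProd_iff (f := fun h : Hist A n × Obs A => F h.2)
    (hF.comp measurable_snd).aestronglyMeasurable]
  refine ⟨Eventually.of_forall (M.integrable_stepKernel L hF hFi n), ?_⟩
  obtain ⟨C, hC⟩ := exists_abs_le (M.obsMean fun o => ‖F o‖)
  refine integrable_of_abs_le (C := C) ?_ fun h => ?_
  · exact ((hF.norm.comp measurable_snd).stronglyMeasurable.integral_kernel_prod_right'
      (κ := M.stepKernel L n)).measurable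
  · rw [M.integral_stepKernel L hF.norm (fun y => (hFi y).norm)]
    exact abs_integral_le_of_abs_le hC

theorem MDP.integrable_obsSum {F : Obs A → ℝ} (hF : Measurable F)
    (hFi : ∀ y, Integrable (fun z => F (y, z)) (M.env y)) :
    ∀ n, Integrable (fun h : Hist A n => Hist.obsSum F h) (M.law L s₀ n)
  | 0 => integrable_zero _ _ _
  | n + 1 =>
    ((M.measurePreserving_fst L s₀ n).integrable_comp_of_integrable
      (MDP.integrable_obsSum hF hFi n)).add (M.integrable_snd L s₀ hF hFi n)

theorem MDP.integral_obsSum_succ {F : Obs A → ℝ} (hF : Measurable F)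
    (hFi : ∀ y, Integrable (fun z => F (y, z)) (M.env y)) (n : ℕ) :
    ∫ h, Hist.obsSum F h ∂(M.law L s₀ (n + 1)) = ∫ h, Hist.obsSum F h ∂(M.law L s₀ n) +
      ∫ h, ∫ y, M.obsMean F y ∂(L.act n h) ∂(M.law L s₀ n) := by
  have h1 := (M.measurePreserving_fst L s₀ n).integrable_comp_of_integrable
    (M.integrable_obsSum L s₀ hF hFi n)
  have h2 := M.integrable_snd L s₀ hF hFi n
  have h3 := integral_add h1 h2
  have h4 := M.integral_comp_fst L s₀ n (Hist.measurable_obsSum hF n)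
  have h5 := Measure.integral_compProd h2
  simp only [M.integral_stepKernel L hF hFi] at h5
  rw [← h4, ← h5]
  exact h3

/-- The expectation of an additive functional only depends on its conditional means. -/
theorem MDP.integral_obsSum {F G : Obs A → ℝ} (hF : Measurable F)
    (hFi : ∀ y, Integrable (fun z => F (y, z)) (M.env y)) (hG : Measurable G)
    (hGi : ∀ y, Integrable (fun z => G (y, z)) (M.env y))
    (hFG : ∀ y, M.obsMean F y = M.obsMean G y) :
    ∀ n, ∫ h, Hist.obsSum F h ∂(M.law L s₀ n) = ∫ h, Hist.obsSum G h ∂(M.law L s₀ n)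
  | 0 => rfl
  | n + 1 => by
    rw [M.integral_obsSum_succ L s₀ hF hFi, M.integral_obsSum_succ L s₀ hG hGi,
      MDP.integral_obsSum hF hFi hG hGi hFG n]
    simp only [hFG]

theorem MDP.integral_obsSum_nonneg {F : Obs A → ℝ} (hF : Measurable F)
    (hFi : ∀ y, Integrable (fun z => F (y, z)) (M.env y))
    (hpos : ∀ n, ∀ᵐ h ∂(M.law L s₀ n), 0 ≤ ∫ y, M.obsMean F y ∂(L.act n h)) :
    ∀ n, 0 ≤ ∫ h, Hist.obsSum F h ∂(M.law L s₀ n)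
  | 0 => (integral_zero _ _).symm.le
  | n + 1 => by
    rw [M.integral_obsSum_succ L s₀ hF hFi]
    exact add_nonneg (MDP.integral_obsSum_nonneg hF hFi hpos n) (integral_nonneg_of_ae (hpos n))

/-- An additive functional with conditional mean zero and increments bounded by `B` has second
moment at most `n B²` after `n` steps: its increments are orthogonal. -/
theorem MDP.integral_obsSum_sq_le {F : Obs A → ℝ} (hF : Measurable F) {B : ℝ}
    (hB : ∀ o, |F o| ≤ B) (h0 : ∀ y, M.obsMean F y = 0) :
    ∀ n, ∫ h, (Hist.obsSum F h) ^ 2 ∂(M.law L s₀ n) ≤ n * B ^ 2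
  | 0 => by simp [Hist.obsSum]
  | n + 1 => by
    have ih := MDP.integral_obsSum_sq_le hF hB h0 n
    have hm := Hist.measurable_obsSum hF n
    have hsq : ∀ {a b : ℝ}, |a| ≤ b → |a ^ 2| ≤ b ^ 2 := fun {a b} hab => by
      rw [abs_pow]
      exact pow_le_pow_left₀ (abs_nonneg _) hab 2
    have i1 : Integrable (fun h : Hist A n => (Hist.obsSum F h) ^ 2) (M.law L s₀ n) :=
      integrable_of_abs_le (hm.pow_const 2) fun h => hsq (Hist.abs_obsSum_le hB h)
    have i1' := (M.measurePreserving_fst L s₀ n).integrable_comp_of_integrable i1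
    have i2 : Integrable (fun h : Hist A n × Obs A => 2 * (Hist.obsSum F h.1 * F h.2))
        (M.law L s₀ n ⊗ₘ M.stepKernel L n) := by
      refine Integrable.const_mul (integrable_of_abs_le (C := n * B * B)
        ((hm.comp measurable_fst).mul (hF.comp measurable_snd)) fun h => ?_) 2
      refine (abs_mul _ _).trans_le ?_
      exact mul_le_mul (Hist.abs_obsSum_le hB h.1) (hB h.2) (abs_nonneg _)
        ((abs_nonneg _).trans (Hist.abs_obsSum_le hB h.1))
    have i3 : Integrable (fun h : Hist A n × Obs A => (F h.2) ^ 2)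
        (M.law L s₀ n ⊗ₘ M.stepKernel L n) :=
      integrable_of_abs_le ((hF.comp measurable_snd).pow_const 2) fun h => hsq (hB h.2)
    have e2 : ∫ h, 2 * (Hist.obsSum F h.1 * F h.2) ∂(M.law L s₀ n ⊗ₘ M.stepKernel L n) = 0 := by
      rw [Measure.integral_compProd i2]
      have : ∀ h : Hist A n, ∫ o, F o ∂(M.stepKernel L n h) = 0 := fun h => by
        rw [M.integral_stepKernel L hF fun y =>
          integrable_of_abs_le (hF.comp measurable_prodMk_left) fun z => hB (y, z)]
        simp [h0]
      simp [integral_const_mul, this]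
    have e3 : ∫ h, (F h.2) ^ 2 ∂(M.law L s₀ n ⊗ₘ M.stepKernel L n) ≤ B ^ 2 :=
      (le_abs_self _).trans (abs_integral_le_of_abs_le fun h => hsq (hB h.2))
    have e1 := M.integral_comp_fst L s₀ n (hm.pow_const 2)
    calc ∫ h, (Hist.obsSum F h) ^ 2 ∂(M.law L s₀ (n + 1))
        = ∫ h, ((Hist.obsSum F h.1) ^ 2 + 2 * (Hist.obsSum F h.1 * F h.2) + (F h.2) ^ 2)
            ∂(M.law L s₀ n ⊗ₘ M.stepKernel L n) := by
          refine integral_congr_ae (Eventually.of_forall fun h : Hist A n × Obs A => ?_)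
          change (Hist.obsSum F h.1 + F h.2) ^ 2 = _
          ring
      _ = ∫ h, (Hist.obsSum F h) ^ 2 ∂(M.law L s₀ n) + 0
            + ∫ h, (F h.2) ^ 2 ∂(M.law L s₀ n ⊗ₘ M.stepKernel L n) := by
          rw [← e1, ← e2]
          exact (integral_add (i1'.add i2) i3).trans (congrArg (· + _) (integral_add i1' i2))
      _ ≤ _ := by
          push_cast
          linarith

end Finite

end

/-! ### Drift of a function of the state -/

section

variable {S : Type u} [MeasurableSpace S] {A : S → Type u}

/-- The mean of `φ` at the state that follows the pair `y`. -/
noncomputable def MDP.nextMean (M : MDP S A) (φ : S → ℝ) (y : Pair A) : ℝ :=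
  ∫ s, φ s ∂(M.trans y).toMeasure

theorem measurable_obs_next [DiscreteMeasurableSpace S] (φ : S → ℝ) :
    Measurable fun o : Obs A => φ o.2.2 :=
  (Measurable.of_discrete (f := φ)).comp (measurable_snd.comp measurable_snd)

section Means

variable (M : MDP S A)

theorem MDP.env_apply (y : Pair A) : M.env y = (M.reward y).prod (M.trans y).toMeasure := rfl

theorem MDP.integrable_env_fst (k : Pair A → ℝ) (y : Pair A) :
    Integrable (fun z => (fun o : Obs A => k o.1) (y, z)) (M.env y) :=
  integrable_const (k y)

theorem MDP.integrable_env_reward (y : Pair A) :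
    Integrable (fun z => (fun o : Obs A => o.2.1) (y, z)) (M.env y) := by
  rw [M.env_apply]
  exact (M.reward_integrable y).comp_fst _

theorem MDP.obsMean_fst (k : Pair A → ℝ) (y : Pair A) : M.obsMean (fun o => k o.1) y = k y := by
  simp [MDP.obsMean]

theorem MDP.obsMean_reward (y : Pair A) : M.obsMean (fun o => o.2.1) y = M.meanReward y := by
  rw [MDP.obsMean, M.env_apply]
  exact (integral_fun_fst (μ := M.reward y) (ν := (M.trans y).toMeasure) fun r => r).trans
    (by simp [MDP.meanReward])

theorem MDP.obsMean_next (φ : S → ℝ) (y : Pair A) :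
    M.obsMean (fun o => φ o.2.2) y = M.nextMean φ y := by
  rw [MDP.obsMean, M.env_apply]
  exact (integral_fun_snd (μ := M.reward y) (ν := (M.trans y).toMeasure) φ).trans
    (by simp [MDP.nextMean])

variable [Finite S] [DiscreteMeasurableSpace S]

theorem MDP.integrable_env_next (φ : S → ℝ) (y : Pair A) :
    Integrable (fun z => (fun o : Obs A => φ o.2.2) (y, z)) (M.env y) := by
  rw [M.env_apply]
  exact Integrable.comp_snd .of_finite _

theorem MDP.obsMean_next_sub (φ : S → ℝ) (k : Pair A → ℝ) (y : Pair A) :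
    M.obsMean (fun o => φ o.2.2 - k o.1) y = M.nextMean φ y - k y := by
  rw [← M.obsMean_next, ← M.obsMean_fst k]
  exact integral_sub (M.integrable_env_next φ y) (M.integrable_env_fst k y)

theorem MDP.integrable_env_next_sub (φ : S → ℝ) (k : Pair A → ℝ) (y : Pair A) :
    Integrable (fun z => (fun o : Obs A => φ o.2.2 - k o.1) (y, z)) (M.env y) :=
  (M.integrable_env_next φ y).sub (M.integrable_env_fst k y)

end Means

section Expectations

variable [Finite S] (M : MDP S A) (L : Learner A) (s₀ : S)

theorem MDP.integrable_obsSum_fst [∀ s, Finite (A s)] (k : Pair A → ℝ) (n : ℕ) :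
    Integrable (fun h : Hist A n => Hist.obsSum (fun o => k o.1) h) (M.law L s₀ n) :=
  M.integrable_obsSum L s₀ (measurable_obs_fst k) (M.integrable_env_fst k) n

theorem MDP.expReward_eq [∀ s, Finite (A s)] (n : ℕ) :
    M.expReward L s₀ n = ∫ h, Hist.obsSum (fun o => M.meanReward o.1) h ∂(M.law L s₀ n) := by
  simp only [MDP.expReward, Hist.totalReward_eq_obsSum]
  refine M.integral_obsSum L s₀ (F := fun o => o.2.1) (measurable_fst.comp measurable_snd)
    M.integrable_env_reward (measurable_obs_fst _) (M.integrable_env_fst _) (fun y => ?_) n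
  rw [M.obsMean_reward, M.obsMean_fst]

theorem MDP.exists_abs_expReward_le [∀ s, Finite (A s)] :
    ∃ R, ∀ n : ℕ, |M.expReward L s₀ n| ≤ n * R := by
  obtain ⟨R, hR⟩ := exists_abs_le M.meanReward
  refine ⟨R, fun n => ?_⟩
  rw [M.expReward_eq]
  exact abs_integral_le_of_abs_le fun h => Hist.abs_obsSum_le (fun o => hR o.1) h

variable [DiscreteMeasurableSpace S]

/-- Telescoping: the state of each pair is the state that followed the previous pair. -/
theorem MDP.ae_obsSum_telescope (φ : S → ℝ) :
    ∀ n, ∀ᵐ h ∂(M.law L s₀ n),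
      Hist.obsSum (fun o => φ o.2.2 - φ o.1.state) h = φ h.cur - φ s₀
  | 0 => by
    have : ∀ᵐ h ∂(Measure.dirac s₀ : Measure S), h = s₀ := by
      rw [ae_dirac_eq]
      rfl
    filter_upwards [this] with h hh
    change 0 = φ h - φ s₀
    rw [hh, sub_self]
  | n + 1 => by
    have hF : Measurable fun o : Obs A => φ o.2.2 - φ o.1.state :=
      (measurable_obs_next φ).sub (measurable_obs_fst fun y => φ y.state)
    refine M.ae_law_succ L s₀ n (p := fun h => Hist.obsSum (fun o => φ o.2.2 - φ o.1.state) h.1 +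
      (φ h.2.2.2 - φ h.2.1.state) = φ h.2.2.2 - φ s₀) ?_ ?_
    · exact measurableSet_eq_fun
        (((Hist.measurable_obsSum hF n).comp measurable_fst).add (hF.comp measurable_snd))
        (((measurable_obs_next φ).comp measurable_snd).sub measurable_const)
    · filter_upwards [MDP.ae_obsSum_telescope φ n] with h hh
      filter_upwards [L.available n h] with y hy
      refine Eventually.of_forall fun z => ?_
      rw [hh, hy]
      ring

variable [∀ s, Finite (A s)]

theorem MDP.integral_obsSum_drift (φ : S → ℝ) (n : ℕ) :
    ∫ h, Hist.obsSum (fun o => M.nextMean φ o.1 - φ o.1.state) h ∂(M.law L s₀ n)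
      = ∫ h, φ h.cur ∂(M.law L s₀ n) - φ s₀ := by
  have h1 := M.integral_obsSum L s₀ (F := fun o => φ o.2.2 - φ o.1.state)
    ((measurable_obs_next φ).sub (measurable_obs_fst fun y => φ y.state))
    (M.integrable_env_next_sub φ fun y => φ y.state)
    (measurable_obs_fst fun y => M.nextMean φ y - φ y.state)
    (M.integrable_env_fst fun y => M.nextMean φ y - φ y.state)
    (fun y => by
      rw [M.obsMean_fst fun y => M.nextMean φ y - φ y.state,
        M.obsMean_next_sub φ fun y => φ y.state]) n
  rw [← h1, integral_congr_ae (M.ae_obsSum_telescope L s₀ φ n), integral_sub _ (integrable_const _)]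
  · simp
  · obtain ⟨H, hH⟩ := exists_abs_le φ
    exact integrable_of_abs_le ((Measurable.of_discrete (f := φ)).comp (Hist.measurable_cur n))
      fun h => hH _

theorem MDP.abs_integral_obsSum_drift_le (φ : S → ℝ) {H : ℝ} (hH : ∀ s, |φ s| ≤ H) (n : ℕ) :
    |∫ h, Hist.obsSum (fun o => M.nextMean φ o.1 - φ o.1.state) h ∂(M.law L s₀ n)| ≤ 2 * H := by
  rw [M.integral_obsSum_drift]
  have h1 : |∫ h, φ h.cur ∂(M.law L s₀ n)| ≤ H := abs_integral_le_of_abs_le fun h => hH _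
  have h2 := abs_le.1 (hH s₀)
  have h3 := abs_le.1 h1
  rw [abs_le]
  constructor <;> linarith

/-- A supersolution of the optimality equation bounds the expected rewards of every learner. -/
theorem MDP.integral_obsSum_le_of_supersolution {ρ : Pair A → ℝ} {φ : S → ℝ} {g H : ℝ}
    (hφ : ∀ y, ρ y + M.nextMean φ y ≤ g + φ y.state) (hH : ∀ s, |φ s| ≤ H) (n : ℕ) :
    ∫ h, Hist.obsSum (fun o => ρ o.1) h ∂(M.law L s₀ n) ≤ n * g + 2 * H := by
  have h1 : ∫ h, Hist.obsSum (fun o => ρ o.1) h ∂(M.law L s₀ n) ≤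
      ∫ h, (n * g - Hist.obsSum (fun o => M.nextMean φ o.1 - φ o.1.state) h) ∂(M.law L s₀ n) := by
    refine integral_mono (M.integrable_obsSum_fst L s₀ ρ n) ((integrable_const _).sub
      (M.integrable_obsSum_fst L s₀ (fun y => M.nextMean φ y - φ y.state) n)) fun h => ?_
    change _ ≤ n * g - Hist.obsSum (fun o => M.nextMean φ o.1 - φ o.1.state) h
    rw [← Hist.obsSum_const g h, ← Hist.obsSum_sub]
    exact Hist.obsSum_mono (fun o => by linarith [hφ o.1]) h
  rw [integral_sub (integrable_const _)
    (M.integrable_obsSum_fst L s₀ (fun y => M.nextMean φ y - φ y.state) n)] at h1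
  have h2 := abs_le.1 (M.abs_integral_obsSum_drift_le L s₀ φ hH n)
  simp only [integral_const, probReal_univ, smul_eq_mul, one_mul] at h1
  linarith

/-- A learner whose decisions satisfy the optimality inequality on average, along almost all
histories, collects the corresponding rewards. -/
theorem MDP.le_integral_obsSum_of_subsolution {ρ : Pair A → ℝ} {φ : S → ℝ} {g H : ℝ}
    (hφ : ∀ n, ∀ᵐ h ∂(M.law L s₀ n),
      g ≤ ∫ y, (ρ y + (M.nextMean φ y - φ y.state)) ∂(L.act n h))
    (hH : ∀ s, |φ s| ≤ H) (n : ℕ) :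
    n * g - 2 * H ≤ ∫ h, Hist.obsSum (fun o => ρ o.1) h ∂(M.law L s₀ n) := by
  let k : Pair A → ℝ := fun y => ρ y + (M.nextMean φ y - φ y.state) - g
  have h1 := M.integral_obsSum_nonneg L s₀ (measurable_obs_fst k) (M.integrable_env_fst k)
    (fun n => by
      filter_upwards [hφ n] with h hh
      simp only [M.obsMean_fst]
      rw [integral_sub .of_finite (integrable_const _)]
      simpa using hh) n
  have h2 : ∀ h : Hist A n, Hist.obsSum (fun o => k o.1) h = Hist.obsSum (fun o => ρ o.1) h +
      Hist.obsSum (fun o => M.nextMean φ o.1 - φ o.1.state) h - n * g := fun h => by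
    rw [← Hist.obsSum_const g h, ← Hist.obsSum_add, ← Hist.obsSum_sub]
  have i1 := M.integrable_obsSum_fst L s₀ ρ n
  have i2 := M.integrable_obsSum_fst L s₀ (fun y => M.nextMean φ y - φ y.state) n
  simp only [h2] at h1
  have h4 := (integral_sub (i1.add i2) (integrable_const (n * g))).trans
    (congrArg (· - _) (integral_add' i1 i2))
  simp only [Pi.add_apply] at h4
  rw [h4] at h1
  have h3 := abs_le.1 (M.abs_integral_obsSum_drift_le L s₀ φ hH n)
  simp only [integral_const, probReal_univ, smul_eq_mul, one_mul] at h1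
  linarith

end Expectations

/-! ### The optimal gain -/

theorem tendsto_add_const_div (g C : ℝ) :
    Tendsto (fun T : ℕ => ((T : ℝ) * g + C) / T) atTop (nhds g) := by
  have h1 : Tendsto (fun T : ℕ => g + C / (T : ℝ)) atTop (nhds (g + 0)) :=
    (tendsto_const_div_atTop_nhds_zero_nat C).const_add g
  rw [add_zero] at h1
  refine h1.congr' ?_
  filter_upwards [eventually_gt_atTop 0] with T hT
  have : (T : ℝ) ≠ 0 := by positivity
  field_simp

section Gain

variable [Finite S] [∀ s, Finite (A s)] (M : MDP S A)

theorem MDP.exists_abs_expReward_div_le (π : Policy A) (s : S) :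
    ∃ R, ∀ T : ℕ, |M.expReward π.toLearner s T / T| ≤ R := by
  obtain ⟨R, hR⟩ := M.exists_abs_expReward_le π.toLearner s
  refine ⟨|R|, fun T => ?_⟩
  rw [abs_div, Nat.abs_cast]
  refine div_le_of_le_mul₀ (Nat.cast_nonneg _) (abs_nonneg _) ((hR T).trans ?_)
  rw [mul_comm]
  exact mul_le_mul_of_nonneg_right (le_abs_self R) (Nat.cast_nonneg _)

theorem MDP.gain_le {π : Policy A} {s : S} {g C : ℝ}
    (h : ∀ T : ℕ, M.expReward π.toLearner s T ≤ T * g + C) : M.gain π s ≤ g := by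
  obtain ⟨R, hR⟩ := M.exists_abs_expReward_div_le π s
  rw [MDP.gain, ← (tendsto_add_const_div g C).liminf_eq]
  refine liminf_le_liminf (Eventually.of_forall fun T =>
    div_le_div_of_nonneg_right (h T) (Nat.cast_nonneg _)) ?_ ?_
  · exact isBoundedUnder_of ⟨-R, fun T => (abs_le.1 (hR T)).1⟩
  · exact (tendsto_add_const_div g C).isCoboundedUnder_ge

theorem MDP.le_gain {π : Policy A} {s : S} {g C : ℝ}
    (h : ∀ T : ℕ, T * g - C ≤ M.expReward π.toLearner s T) : g ≤ M.gain π s := by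
  obtain ⟨R, hR⟩ := M.exists_abs_expReward_div_le π s
  rw [MDP.gain, ← (tendsto_add_const_div g (-C)).liminf_eq]
  refine liminf_le_liminf (Eventually.of_forall fun T =>
    div_le_div_of_nonneg_right (by linarith [h T]) (Nat.cast_nonneg _)) ?_ ?_
  · exact (tendsto_add_const_div g (-C)).isBoundedUnder_ge
  · exact (isBoundedUnder_of ⟨R, fun T => (abs_le.1 (hR T)).2⟩ :
      IsBoundedUnder (· ≤ ·) _ _).isCoboundedUnder_ge

variable [DiscreteMeasurableSpace S]

/-- `(g, φ)` solves the average-reward optimality equation of `M`; the maximum over the actions is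
written as an upper bound that is attained in every state. -/
def MDP.OptimalityEquation (M : MDP S A) (g : ℝ) (φ : S → ℝ) : Prop :=
  (∀ y, M.meanReward y + M.nextMean φ y ≤ g + φ y.state) ∧
    ∀ s, ∃ y : Pair A, y.state = s ∧ g + φ s ≤ M.meanReward y + M.nextMean φ y

theorem MDP.Communicating.exists_optimalityEquation {M : MDP S A} (hM : M.Communicating)
    (hA : ∀ s, ∃ y : Pair A, y.state = s) : ∃ g φ, M.OptimalityEquation g φ := by
  have := Fintype.ofFinite S
  rcases isEmpty_or_nonempty S with hS | hS
  · exact ⟨0, 0, fun y => isEmptyElim y.state, fun s => isEmptyElim s⟩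
  have hsum : ∀ (y : Pair A) (φ : S → ℝ), M.nextMean φ y = ∑ s, (M.trans y s).toReal * φ s :=
    fun y φ => PMF.integral_eq_sum (M.trans y) φ
  obtain ⟨g, φ, h1, h2⟩ := exists_optimality_equation Pair.state hA
    (fun y s => (M.trans y s).toReal) (fun _ _ => ENNReal.toReal_nonneg)
    (fun y => by
      have := hsum y fun _ => 1
      simpa [MDP.nextMean] using this.symm) M.meanReward
    (fun s s' => Relation.ReflTransGen.mono (fun a b ⟨y, hy, hb⟩ =>
      ⟨y, hy, (ENNReal.toReal_pos hb (PMF.apply_ne_top _ _)).ne'⟩) s s' (hM s s'))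
  refine ⟨g, φ, fun y => ?_, fun s => ?_⟩
  · rw [hsum]
    exact h1 y
  · obtain ⟨y, hy, h⟩ := h2 s
    exact ⟨y, hy, by rwa [hsum]⟩

theorem MDP.OptimalityEquation.gain_le {M : MDP S A} {g : ℝ} {φ : S → ℝ}
    (h : M.OptimalityEquation g φ) (π : Policy A) (s : S) : M.gain π s ≤ g := by
  obtain ⟨H, hH⟩ := exists_abs_le φ
  refine M.gain_le (C := 2 * H) fun T => ?_
  rw [M.expReward_eq]
  exact M.integral_obsSum_le_of_supersolution _ s h.1 hH T

/-- The policy that plays the pair `f s` in the state `s`. -/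
noncomputable def Policy.ofFun (f : S → Pair A) (hf : ∀ s, (f s).state = s) : Policy A where
  act := Kernel.deterministic f Measurable.of_discrete
  markov := inferInstance
  available s := by
    rw [Kernel.deterministic_apply, ae_dirac_eq]
    exact hf s

/-- The gain of the optimality equation is achieved by a greedy policy. -/
theorem MDP.OptimalityEquation.le_optGain {M : MDP S A} {g : ℝ} {φ : S → ℝ}
    (h : M.OptimalityEquation g φ) (s : S) : g ≤ M.optGain s := by
  choose f hf hfg using h.2
  obtain ⟨H, hH⟩ := exists_abs_le φ
  have h1 : g ≤ M.gain (Policy.ofFun f hf) s := by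
    refine M.le_gain (C := 2 * H) fun T => ?_
    rw [M.expReward_eq]
    refine M.le_integral_obsSum_of_subsolution _ s (fun n => Eventually.of_forall fun h' => ?_) hH T
    change g ≤ ∫ y, _ ∂(Kernel.deterministic f Measurable.of_discrete h'.cur)
    rw [Kernel.deterministic_apply, integral_dirac, hf]
    linarith [hfg h'.cur]
  -- the gains are bounded above, so that the supremum is not a junk value
  exact h1.trans (le_ciSup (f := fun π => M.gain π s)
    ⟨g, Set.forall_mem_range.2 fun π => h.gain_le π s⟩ _)

end Gain

end

/-! ### Visits of a recurrent pair -/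

section

/-- If a state with `f > 0` can be reached from every state of `C` by steps with `Q > 0`, then some
function `u` certifies that `f` is collected at a positive rate in `C`: `u` is the Cesàro mean of
the expected totals of `f` over short horizons. -/
theorem exists_potential {S : Type*} [Fintype S] (Q : S → S → ℝ) (hQ : ∀ s t, 0 ≤ Q s t)
    (f : S → ℝ) (hf : ∀ s, 0 ≤ f s) (s₁ : S) (hs₁ : 0 < f s₁) (C : Set S)
    (hC : ∀ s ∈ C, Relation.ReflTransGen (fun s t => 0 < Q s t) s s₁) :
    ∃ (c : ℝ) (u : S → ℝ), 0 < c ∧ ∀ s ∈ C, c + u s ≤ f s + ∑ t, Q s t * u t := by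
  -- `V n s` is the expected total of `f` over `n` steps from `s`
  let V : ℕ → S → ℝ := fun n => (fun v s => f s + ∑ t, Q s t * v t)^[n] 0
  have hV : ∀ n s, V (n + 1) s = f s + ∑ t, Q s t * V n t := fun n s => by
    simp only [V, Function.iterate_succ_apply']
  have hV0 : ∀ n s, 0 ≤ V n s := by
    intro n
    induction n with
    | zero => exact fun s => le_rfl
    | succ n ih =>
      intro s
      rw [hV]
      exact add_nonneg (hf s) (Finset.sum_nonneg fun t _ => mul_nonneg (hQ s t) (ih t))
  have hmono : Monotone V := by
    refine monotone_nat_of_le_succ fun n => ?_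
    induction n with
    | zero => exact fun s => hV0 1 s
    | succ n ih =>
      intro s
      rw [hV, hV]
      gcongr with t
      · exact hQ s t
      · exact ih t
  have hpos : ∀ s ∈ C, ∃ n, 0 < V n s := by
    intro s hs
    have := hC s hs
    clear hs
    induction this using Relation.ReflTransGen.head_induction_on with
    | refl =>
      refine ⟨1, ?_⟩
      rw [hV]
      exact add_pos_of_pos_of_nonneg hs₁
        (Finset.sum_nonneg fun t _ => mul_nonneg (hQ _ t) (hV0 0 t))
    | head hst _ ih =>
      rename_i s t _
      obtain ⟨n, hn⟩ := ih
      refine ⟨n + 1, ?_⟩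
      rw [hV]
      refine add_pos_of_nonneg_of_pos (hf s) ((mul_pos hst hn).trans_le ?_)
      exact Finset.single_le_sum (f := fun t => Q s t * V n t)
        (fun t _ => mul_nonneg (hQ s t) (hV0 n t)) (Finset.mem_univ t)
  choose! N hN using hpos
  obtain ⟨K, hK⟩ := (Set.finite_range N).bddAbove
  have hK1 : ∀ s ∈ C, 0 < V (K + 1) s := fun s hs =>
    (hN s hs).trans_le (hmono ((hK ⟨s, rfl⟩).trans (Nat.le_succ K)) s)
  obtain ⟨p, hp, hpC⟩ : ∃ p : ℝ, 0 < p ∧ ∀ s ∈ C, p ≤ V (K + 1) s := by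
    rcases C.eq_empty_or_nonempty with rfl | hne
    · exact ⟨1, one_pos, by simp⟩
    · obtain ⟨s, hs, hmin⟩ := Set.exists_min_image C (V (K + 1)) (Set.toFinite C) hne
      exact ⟨_, hK1 s hs, hmin⟩
  have hn : (0 : ℝ) < (K : ℝ) + 1 := by positivity
  refine ⟨p / (K + 1), fun s => (∑ n ∈ Finset.range (K + 1), V n s) / (K + 1), by positivity,
    fun s hs => ?_⟩
  have h1 : ∑ n ∈ Finset.range (K + 1), V (n + 1) s
      = (K + 1) * f s + ∑ t, Q s t * ∑ n ∈ Finset.range (K + 1), V n t := by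
    simp only [hV, Finset.sum_add_distrib, Finset.mul_sum]
    rw [Finset.sum_comm]
    simp
  have h2 : ∑ n ∈ Finset.range (K + 1), V (n + 1) s
      = ∑ n ∈ Finset.range (K + 1), V n s + V (K + 1) s := by
    have h3 := Finset.sum_range_succ (fun n => V n s) (K + 1)
    rw [Finset.sum_range_succ'] at h3
    simpa [V] using h3
  have h4 : ∑ t, Q s t * ((∑ n ∈ Finset.range (K + 1), V n t) / (K + 1))
      = (∑ t, Q s t * ∑ n ∈ Finset.range (K + 1), V n t) / (K + 1) := by
    rw [Finset.sum_div]
    exact Finset.sum_congr rfl fun t _ => by ring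
  rw [h4, ← add_div, div_le_iff₀ hn, add_mul, div_mul_cancel₀ _ hn.ne']
  linarith [hpC s hs]

variable {S : Type u} [MeasurableSpace S] {A : S → Type u}

open Classical in
theorem MDP.expVisits_eq (M : MDP S A) (L : Learner A) (s₀ : S) (x : Pair A) (n : ℕ) :
    M.expVisits L s₀ x n
      = ∫ h, Hist.obsSum (fun o => if o.1 = x then 1 else 0) h ∂(M.law L s₀ n) := by
  simp only [MDP.expVisits, Hist.visits_eq_obsSum]

variable [Finite S]

theorem Policy.ae_act [∀ s, Finite (A s)] (π : Policy A) (s : S) :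
    ∀ᵐ y ∂(π.act s), π.act s {y} ≠ 0 := by
  rw [ae_iff_of_countable]
  exact fun y hy => hy

variable [DiscreteMeasurableSpace S]

theorem MDP.ae_env_next (M : MDP S A) (y : Pair A) : ∀ᵐ z ∂(M.env y), M.trans y z.2 ≠ 0 := by
  have h : ∀ᵐ s ∂(M.trans y).toMeasure, M.trans y s ≠ 0 := by
    rw [ae_iff_of_countable]
    intro s hs
    rwa [PMF.toMeasure_apply_singleton _ _ (MeasurableSet.singleton s)] at hs
  rw [M.env_apply]
  exact Measure.quasiMeasurePreserving_snd.ae h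

variable [∀ s, Finite (A s)]

/-- A stationary policy stays in the set of states that it can reach. -/
theorem MDP.ae_reachable (M : MDP S A) (π : Policy A) (s₀ : S) :
    ∀ n, ∀ᵐ h ∂(M.law π.toLearner s₀ n), Relation.ReflTransGen (M.PolicyStep π) s₀ h.cur
  | 0 => by
    change ∀ᵐ h ∂(Measure.dirac s₀ : Measure S), Relation.ReflTransGen (M.PolicyStep π) s₀ h
    rw [ae_dirac_eq]
    exact Relation.ReflTransGen.refl
  | n + 1 => by
    refine M.ae_law_succ _ s₀ n (p := fun h => Relation.ReflTransGen (M.PolicyStep π) s₀ h.2.2.2)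
      ?_ ?_
    · exact (MeasurableSet.of_discrete
        (s := {s | Relation.ReflTransGen (M.PolicyStep π) s₀ s})).preimage
        (measurable_snd.comp (measurable_snd.comp measurable_snd))
    · filter_upwards [MDP.ae_reachable M π s₀ n] with h hh
      change ∀ᵐ y ∂(π.act h.cur), _
      filter_upwards [π.ae_act h.cur] with y hy
      filter_upwards [M.ae_env_next y] with z hz
      exact hh.tail ⟨y, hy, hz⟩

/-- A pair that is recurrent under a policy is visited at a positive rate. -/
theorem MDP.IsRecurrentPair.exists_le_expVisits {M : MDP S A} {π : Policy A} {x : Pair A}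
    (hx : M.IsRecurrentPair π x) :
    ∃ c C : ℝ, 0 < c ∧ ∀ T : ℕ, T * c - C ≤ M.expVisits π.toLearner x.state x T := by
  classical
  have := Fintype.ofFinite S
  let Q : S → S → ℝ := fun s t => ∫ y, (M.trans y t).toReal ∂(π.act s)
  let f : S → ℝ := fun s => ∫ y, (if y = x then 1 else 0) ∂(π.act s)
  have hQ : ∀ s t, 0 ≤ Q s t := fun s t => integral_nonneg fun y => ENNReal.toReal_nonneg
  have hf : ∀ s, f s = (π.act s).real {x} := fun s => by
    rw [← integral_indicator_one (MeasurableSet.singleton x)]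
    refine integral_congr_ae (Eventually.of_forall fun y => ?_)
    simp [Set.indicator_apply]
  have hstep : ∀ s t, M.PolicyStep π s t → 0 < Q s t := by
    rintro s t ⟨y, hy, ht⟩
    have h1 : (π.act s).real {y} * (M.trans y t).toReal ≤ Q s t := by
      rw [← smul_eq_mul, ← integral_indicator_const _ (MeasurableSet.singleton y)]
      refine integral_mono .of_finite .of_finite fun z => ?_
      by_cases hz : z = y
      · simp [hz]
      · simp [hz]
    refine lt_of_lt_of_le (mul_pos ?_ ?_) h1
    · exact ENNReal.toReal_pos hy (measure_ne_top _ _)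
    · exact ENNReal.toReal_pos ht (PMF.apply_ne_top _ _)
  obtain ⟨c, u, hc, hu⟩ := exists_potential Q hQ f
    (fun s => by rw [hf]; exact measureReal_nonneg) x.state
    (by rw [hf]; exact ENNReal.toReal_pos hx.1 (measure_ne_top _ _))
    {s | Relation.ReflTransGen (M.PolicyStep π) x.state s}
    (fun s hs => Relation.ReflTransGen.mono hstep _ _ (hx.2 s hs))
  obtain ⟨H, hH⟩ := exists_abs_le u
  refine ⟨c, 2 * H, hc, fun T => ?_⟩
  rw [M.expVisits_eq]
  refine M.le_integral_obsSum_of_subsolution π.toLearner x.state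
    (ρ := fun y => if y = x then 1 else 0) (φ := u) (fun n => ?_) hH T
  filter_upwards [M.ae_reachable π x.state n] with h hh
  change c ≤ ∫ y, _ ∂(π.act h.cur)
  have h1 := hu _ hh
  have h2 : ∫ y, M.nextMean u y ∂(π.act h.cur) = ∑ t, Q h.cur t * u t := by
    have : ∀ y, M.nextMean u y = ∑ t, (M.trans y t).toReal * u t := fun y =>
      PMF.integral_eq_sum (M.trans y) u
    simp only [this, Q, ← integral_mul_const]
    exact integral_finsetSum _ fun t _ => .of_finite
  have h3 : ∫ y : Pair A, u y.state ∂(π.act h.cur) = u h.cur := by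
    have : (fun y : Pair A => u y.state) =ᵐ[π.act h.cur] fun _ => u h.cur := by
      filter_upwards [π.available h.cur] with y hy
      rw [hy]
    rw [integral_congr_ae this]
    simp
  rw [integral_add .of_finite .of_finite, integral_sub .of_finite .of_finite, h2, h3]
  change c ≤ f h.cur + _
  linarith

/-- Raising the mean reward of a recurrent pair of a policy raises the optimal gain strictly above
the gain of this policy. -/
theorem MDP.OptimalityEquation.gain_lt {M M' : MDP S A} {g' : ℝ} {φ' : S → ℝ}
    (h : M'.OptimalityEquation g' φ') {x : Pair A} (hd : M.DiffersOnlyInRewardAt M' x)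
    (hlt : M.meanReward x < M'.meanReward x) {π : Policy A} (hx : M.IsRecurrentPair π x) :
    M.gain π x.state < g' := by
  classical
  -- the law of `π` in `M` is kept and only the mean rewards are changed: `φ'` is a supersolution for
  -- the new rewards and the unchanged transitions
  obtain ⟨c, C, hc, hcC⟩ := hx.exists_le_expVisits
  obtain ⟨H, hH⟩ := exists_abs_le φ'
  set Δ := M'.meanReward x - M.meanReward x with hΔ
  have hΔ0 : 0 < Δ := sub_pos.2 hlt
  have key : M.gain π x.state ≤ g' - Δ * c := by
    refine M.gain_le (C := 2 * H + Δ * C) fun T => ?_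
    have h1 := M.integral_obsSum_le_of_supersolution π.toLearner x.state
      (ρ := fun y => M.meanReward y + Δ * if y = x then 1 else 0) (φ := φ') (g := g') (fun y => ?_)
      hH T
    · simp only [Hist.obsSum_add (fun o => M.meanReward o.1)
        (fun o => Δ * if o.1 = x then 1 else 0), Hist.obsSum_const_mul] at h1
      rw [integral_add (M.integrable_obsSum_fst _ _ _ T)
        ((M.integrable_obsSum_fst _ _ (fun y => if y = x then 1 else 0) T).const_mul Δ),
        integral_const_mul, ← M.expReward_eq, ← M.expVisits_eq] at h1
      nlinarith [mul_le_mul_of_nonneg_left (hcC T) hΔ0.le]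
    · have h2 := h.1 y
      have h3 : M'.nextMean φ' y = M.nextMean φ' y := by rw [MDP.nextMean, hd.1]; rfl
      have h4 : M.meanReward y + (Δ * if y = x then 1 else 0) = M'.meanReward y := by
        by_cases hy : y = x
        · simp [hy, hΔ]
        · simp [hy, MDP.meanReward, hd.2.1 y hy]
      rw [h4, ← h3]
      exact h2
  nlinarith

end

/-! ### The relative entropy of two models that differ in one reward distribution -/

section

variable {S : Type u} [MeasurableSpace S] {A : S → Type u}

theorem MDP.DiffersOnlyInRewardAt.env_eq {M M' : MDP S A} {x : Pair A}
    (hd : M.DiffersOnlyInRewardAt M' x) {y : Pair A} (hy : y ≠ x) : M'.env y = M.env y := by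
  rw [M.env_apply, M'.env_apply, hd.1, hd.2.1 y hy]

theorem MDP.DiffersOnlyInRewardAt.entropyBound_env {M M' : MDP S A} {x : Pair A}
    (hd : M.DiffersOnlyInRewardAt M' x)
    (hkl : InformationTheory.klDiv (M.reward x) (M'.reward x) ≠ ⊤) :
    EntropyBound (M.env x) (M'.env x)
      (InformationTheory.klDiv (M.reward x) (M'.reward x)).toReal := by
  rw [M.env_apply, M'.env_apply, hd.1, ← Measure.compProd_const, ← Measure.compProd_const]
  simpa using (entropyBound_of_klDiv_ne_top hkl).compProd
    (κ := Kernel.const ℝ (M.trans x).toMeasure) (η := Kernel.const ℝ (M.trans x).toMeasure)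
    (integrable_zero _ _ _) fun _ => entropyBound_self _

/-- The divergence decomposition: relative entropy accumulates only at the visits of the pair where
the two models differ. -/
theorem MDP.DiffersOnlyInRewardAt.entropyBound_law [Finite (Pair A)] {M M' : MDP S A} {x : Pair A}
    (hd : M.DiffersOnlyInRewardAt M' x)
    (hkl : InformationTheory.klDiv (M.reward x) (M'.reward x) ≠ ⊤) (L : Learner A) (s₀ : S) :
    ∀ n, EntropyBound (M.law L s₀ n) (M'.law L s₀ n)
      ((InformationTheory.klDiv (M.reward x) (M'.reward x)).toReal * M.expVisits L s₀ x n)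
  | 0 => by
    have h0 : M.expVisits L s₀ x 0 = 0 := by simp [MDP.expVisits, Hist.visits]
    rw [h0, mul_zero]
    exact entropyBound_self (M.law L s₀ 0)
  | n + 1 => by
    classical
    set D := (InformationTheory.klDiv (M.reward x) (M'.reward x)).toReal
    have hstep : ∀ h : Hist A n, EntropyBound (M.stepKernel L n h) (M'.stepKernel L n h)
        (∫ y, D * (if y = x then 1 else 0) ∂(L.act n h)) := by
      intro h
      rw [M.stepKernel_apply, M'.stepKernel_apply]
      simpa only [zero_add] using (entropyBound_self (L.act n h)).compProd .of_finite fun y => by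
        by_cases hy : y = x
        · subst hy
          simpa using hd.entropyBound_env hkl
        · rw [hd.env_eq hy]
          simpa [hy] using entropyBound_self (M.env y)
    have hm : Measurable fun h : Hist A n => ∫ y, D * (if y = x then 1 else 0) ∂(L.act n h) :=
      ((measurable_of_countable fun y : Pair A => D * (if y = x then 1 else 0)).comp
        measurable_snd).stronglyMeasurable.integral_kernel_prod_right' (κ := L.act n) |>.measurable
    have hi : Integrable (fun h : Hist A n => ∫ y, D * (if y = x then 1 else 0) ∂(L.act n h))
        (M.law L s₀ n) := by
      obtain ⟨C, hC⟩ := exists_abs_le fun y : Pair A => D * (if y = x then 1 else 0)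
      exact integrable_of_abs_le hm fun h => abs_integral_le_of_abs_le hC
    have hlaw := (MDP.DiffersOnlyInRewardAt.entropyBound_law hd hkl L s₀ n).compProd hi hstep
    have hsum := M.integral_obsSum_succ L s₀ (measurable_obs_fst fun y => if y = x then 1 else 0)
      (M.integrable_env_fst fun y => if y = x then 1 else 0) n
    rw [← M.expVisits_eq, ← M.expVisits_eq] at hsum
    rw [hsum, mul_add, ← integral_const_mul]
    simp only [M.obsMean_fst fun y => if y = x then (1 : ℝ) else 0, ← integral_const_mul]
    exact hlaw

end

/-! ### Few visits are unlikely under the perturbed model -/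

section

variable {S : Type u} [MeasurableSpace S] {A : S → Type u}

theorem measurable_visits (x : Pair A) (n : ℕ) :
    Measurable fun h : Hist A n => (h.visits x : ℝ) := by
  classical
  simp only [Hist.visits_eq_obsSum]
  exact Hist.measurable_obsSum (measurable_obs_fst fun y => if y = x then 1 else 0) n

variable [Finite S] [DiscreteMeasurableSpace S]

theorem MDP.nextMean_sub (M : MDP S A) (φ ψ : S → ℝ) (y : Pair A) :
    M.nextMean (fun s => φ s - ψ s) y = M.nextMean φ y - M.nextMean ψ y :=
  integral_sub .of_finite .of_finite

/-- The suboptimality gap of the pair `y` relative to a solution of the optimality equation. -/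
noncomputable def MDP.gap (M : MDP S A) (g : ℝ) (φ : S → ℝ) (y : Pair A) : ℝ :=
  g + φ y.state - M.meanReward y - M.nextMean φ y

/-- Along almost all histories, the gaps in the perturbed model add up to at least the number of
steps times the difference of the optimal gains, minus a multiple of the number of visits of the
perturbed pair, up to a martingale and a constant. -/
theorem MDP.DiffersOnlyInRewardAt.ae_le_obsSum_gap {M M' : MDP S A} {x : Pair A}
    (hd : M.DiffersOnlyInRewardAt M' x) {g g' : ℝ} {φ φ' : S → ℝ}
    (h : M.OptimalityEquation g φ) {H : ℝ} (hH : ∀ s, |φ' s - φ s| ≤ H) (L : Learner A) (s₀ : S)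
    (T : ℕ) :
    ∀ᵐ h ∂(M'.law L s₀ T),
      T * (g' - g) - (M'.meanReward x - M.meanReward x) * h.visits x - 2 * H +
        Hist.obsSum (fun o => φ' o.2.2 - φ o.2.2 - M'.nextMean (fun s => φ' s - φ s) o.1) h
      ≤ Hist.obsSum (fun o => M'.gap g' φ' o.1) h := by
  classical
  filter_upwards [M'.ae_obsSum_telescope L s₀ (fun s => φ' s - φ s) T] with p hp
  have hle : ∀ o : Obs A,
      (g' - g) - (M'.meanReward x - M.meanReward x) * (if o.1 = x then 1 else 0) +
        ((φ' o.2.2 - φ o.2.2 - M'.nextMean (fun s => φ' s - φ s) o.1) -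
          (φ' o.2.2 - φ o.2.2 - (φ' o.1.state - φ o.1.state))) ≤ M'.gap g' φ' o.1 := by
    intro o
    have h1 := h.1 o.1
    have h2 : M'.nextMean φ o.1 = M.nextMean φ o.1 := by rw [MDP.nextMean, hd.1]; rfl
    have h3 : (M'.meanReward x - M.meanReward x) * (if o.1 = x then 1 else 0)
        = M'.meanReward o.1 - M.meanReward o.1 := by
      by_cases hy : o.1 = x
      · simp [hy]
      · simp [hy, MDP.meanReward, hd.2.1 _ hy]
    rw [M'.nextMean_sub, h2, h3, MDP.gap]
    linarith
  have hsum := Hist.obsSum_mono hle p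
  rw [Hist.obsSum_add (fun o : Obs A => (g' - g) - (M'.meanReward x - M.meanReward x) *
    (if o.1 = x then 1 else 0)), Hist.obsSum_sub (fun _ => g' - g), Hist.obsSum_const,
    Hist.obsSum_const_mul, ← Hist.visits_eq_obsSum,
    Hist.obsSum_sub (fun o : Obs A => φ' o.2.2 - φ o.2.2 - M'.nextMean (fun s => φ' s - φ s) o.1),
    hp] at hsum
  have h4 := abs_le.1 (hH p.cur)
  have h5 := abs_le.1 (hH s₀)
  linarith

variable [∀ s, Finite (A s)]

/-- The expected sum of the gaps is the regret, up to a constant. -/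
theorem MDP.OptimalityEquation.integral_obsSum_gap_le {M : MDP S A} {g : ℝ} {φ : S → ℝ}
    (h : M.OptimalityEquation g φ) {H : ℝ} (hH : ∀ s, |φ s| ≤ H) (L : Learner A) (s₀ : S) (T : ℕ) :
    ∫ h, Hist.obsSum (fun o => M.gap g φ o.1) h ∂(M.law L s₀ T) ≤ M.regret L s₀ T + 2 * H := by
  have h1 : ∀ h : Hist A T, Hist.obsSum (fun o => M.gap g φ o.1) h =
      T * g - (Hist.obsSum (fun o => M.meanReward o.1) h +
        Hist.obsSum (fun o => M.nextMean φ o.1 - φ o.1.state) h) := fun h => by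
    rw [← Hist.obsSum_const g h, ← Hist.obsSum_add, ← Hist.obsSum_sub]
    congr 1
    ext o
    rw [MDP.gap]
    ring
  have i1 := M.integrable_obsSum_fst L s₀ M.meanReward T
  have i2 := M.integrable_obsSum_fst L s₀ (fun y => M.nextMean φ y - φ y.state) T
  have h2 := (integral_sub (integrable_const (T * g)) (i1.add i2)).trans
    (congrArg (_ - ·) (integral_add' i1 i2))
  simp only [Pi.add_apply] at h2
  simp only [h1]
  rw [h2, ← M.expReward_eq, MDP.regret]
  have h3 := abs_le.1 (M.abs_integral_obsSum_drift_le L s₀ φ hH T)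
  have h4 := mul_le_mul_of_nonneg_left (h.le_optGain s₀) (Nat.cast_nonneg (α := ℝ) T)
  simp only [integral_const, probReal_univ, smul_eq_mul, one_mul]
  linarith

/-- If the optimal gain of `M'` exceeds that of `M`, a learner with regret `o(√T)` on `M'` visits
the perturbed pair less than `a T` times with probability `O(1 / √T)` under `M'`. -/
theorem MDP.DiffersOnlyInRewardAt.exists_measure_few_visits_le {M M' : MDP S A} {x : Pair A}
    (hd : M.DiffersOnlyInRewardAt M' x) (hlt : M.meanReward x < M'.meanReward x)
    {g g' : ℝ} {φ φ' : S → ℝ} (h : M.OptimalityEquation g φ) (h' : M'.OptimalityEquation g' φ')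
    (hg : g < g') (L : Learner A) (s₀ : S)
    (hreg : (fun T : ℕ => M'.regret L s₀ T) =o[atTop] fun T : ℕ => (T : ℝ) ^ (1 / 2 : ℝ)) :
    ∃ a c : ℝ, 0 < a ∧ ∀ᶠ T : ℕ in atTop,
      (M'.law L s₀ T).real {h | (h.visits x : ℝ) < a * T} * Real.sqrt T ≤ c := by
  obtain ⟨H', hH'⟩ := exists_abs_le φ'
  obtain ⟨H, hH⟩ := exists_abs_le fun s => φ' s - φ s
  have hH0 : 0 ≤ H := (abs_nonneg _).trans (hH s₀)
  have hH'0 : 0 ≤ H' := (abs_nonneg _).trans (hH' s₀)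
  set δ := g' - g with hδ
  have hδ0 : 0 < δ := sub_pos.2 hg
  set Δ := M'.meanReward x - M.meanReward x with hΔ
  have hΔ0 : 0 < Δ := sub_pos.2 hlt
  -- visiting `x` less than `a T` times recovers at most a quarter of the loss `δ T`
  refine ⟨δ / (4 * Δ), (1 + 2 * H') * 4 / δ + 64 * H ^ 2 / δ ^ 2, by positivity, ?_⟩
  have hreg1 := hreg.bound one_pos
  have hT2 : ∀ᶠ T : ℕ in atTop, 8 * H / δ ≤ T := tendsto_natCast_atTop_atTop.eventually_ge_atTop _
  filter_upwards [hreg1, hT2, eventually_ge_atTop 1] with T hregT hTH hT1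
  have hT1' : (1 : ℝ) ≤ T := by exact_mod_cast hT1
  rw [div_le_iff₀ hδ0] at hTH
  rw [← Real.sqrt_eq_rpow, Real.norm_eq_abs, Real.norm_eq_abs, abs_of_nonneg (Real.sqrt_nonneg _),
    one_mul] at hregT
  set E : Set (Hist A T) := {h | (h.visits x : ℝ) < δ / (4 * Δ) * T} with hE
  have hEm : MeasurableSet E := measurableSet_lt (measurable_visits x T) measurable_const
  set w := δ * T / 4 with hw
  have hw0 : 0 < w := by positivity
  let F : Obs A → ℝ := fun o => φ' o.2.2 - φ o.2.2 - M'.nextMean (fun s => φ' s - φ s) o.1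
  have hF : Measurable F := (measurable_obs_next fun s => φ' s - φ s).sub
    (measurable_obs_fst fun y => M'.nextMean (fun s => φ' s - φ s) y)
  have hFB : ∀ o, |F o| ≤ 2 * H := fun o => by
    have h1 : |M'.nextMean (fun s => φ' s - φ s) o.1| ≤ H := abs_integral_le_of_abs_le hH
    calc |F o| ≤ |φ' o.2.2 - φ o.2.2| + |M'.nextMean (fun s => φ' s - φ s) o.1| := abs_sub _ _
      _ ≤ 2 * H := by linarith [hH o.2.2]
  have hF0 : ∀ y, M'.obsMean F y = 0 := fun y => by
    have := M'.obsMean_next_sub (fun s => φ' s - φ s) (M'.nextMean fun s => φ' s - φ s) y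
    rw [sub_self] at this
    exact this
  have hZ := M'.integral_obsSum_sq_le L s₀ hF hFB hF0 T
  have hG := h'.integral_obsSum_gap_le hH' L s₀ T
  -- a history with few visits has a large total gap or a large martingale term
  have hpt : ∀ᵐ p ∂(M'.law L s₀ T), E.indicator (fun _ => w ^ 2) p ≤
      w * Hist.obsSum (fun o => M'.gap g' φ' o.1) p + (Hist.obsSum F p) ^ 2 := by
    filter_upwards [hd.ae_le_obsSum_gap (g' := g') (φ' := φ') h hH L s₀ T] with p hp
    have hG0 : 0 ≤ Hist.obsSum (fun o => M'.gap g' φ' o.1) p := by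
      have := Hist.obsSum_mono (F := fun _ => 0) (G := fun o => M'.gap g' φ' o.1)
        (fun o => by rw [MDP.gap]; linarith [h'.1 o.1]) p
      rwa [Hist.obsSum_const, mul_zero] at this
    by_cases hpE : p ∈ E
    · rw [Set.indicator_of_mem hpE]
      have h1 : Δ * p.visits x ≤ w := by
        have h2 : (p.visits x : ℝ) < δ / (4 * Δ) * T := hpE
        calc Δ * p.visits x ≤ Δ * (δ / (4 * Δ) * T) := mul_le_mul_of_nonneg_left h2.le hΔ0.le
          _ = w := by rw [hw]; field_simp
      change T * δ - Δ * p.visits x - 2 * H + Hist.obsSum F p ≤ _ at hp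
      rcases le_or_gt w (Hist.obsSum (fun o => M'.gap g' φ' o.1) p) with h3 | h3
      · nlinarith [sq_nonneg (Hist.obsSum F p)]
      · have h4 : Hist.obsSum F p ≤ -w := by linarith
        nlinarith [mul_nonneg hw0.le hG0]
    · rw [Set.indicator_of_notMem hpE]
      positivity
  have iG := M'.integrable_obsSum_fst L s₀ (M'.gap g' φ') T
  have iZ : Integrable (fun p : Hist A T => (Hist.obsSum F p) ^ 2) (M'.law L s₀ T) :=
    integrable_of_abs_le ((Hist.measurable_obsSum hF T).pow_const 2) (C := (T * (2 * H)) ^ 2)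
      fun p => by
        rw [abs_pow]
        exact pow_le_pow_left₀ (abs_nonneg _) (Hist.abs_obsSum_le hFB p) 2
  have hint := integral_mono_ae ((integrable_const (w ^ 2)).indicator hEm)
    ((iG.const_mul w).add iZ) hpt
  have hsplit := (integral_add' (iG.const_mul w) iZ).trans
    (congrArg (· + _) (integral_const_mul w _))
  rw [hsplit, integral_indicator_const _ hEm, smul_eq_mul] at hint
  have hs : 1 ≤ Real.sqrt T := Real.one_le_sqrt.2 hT1'
  have hss : Real.sqrt T * Real.sqrt T = T := Real.mul_self_sqrt (by linarith)
  have hG2 : ∫ p, Hist.obsSum (fun o => M'.gap g' φ' o.1) p ∂(M'.law L s₀ T)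
      ≤ (1 + 2 * H') * Real.sqrt T := by
    nlinarith [(abs_le.1 hregT).2]
  have hT4 : (T : ℝ) = 4 * w / δ := by rw [hw]; field_simp
  have hfin : (M'.law L s₀ T).real E * Real.sqrt T * w ^ 2 ≤
      ((1 + 2 * H') * 4 / δ + 64 * H ^ 2 / δ ^ 2) * w ^ 2 := by
    have h1 : (M'.law L s₀ T).real E * w ^ 2 ≤
        w * ((1 + 2 * H') * Real.sqrt T) + T * (2 * H) ^ 2 :=
      hint.trans (add_le_add (mul_le_mul_of_nonneg_left hG2 hw0.le) hZ)
    have h2 := mul_le_mul_of_nonneg_right h1 (Real.sqrt_nonneg T)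
    have h3 : Real.sqrt T ≤ T := by nlinarith
    calc (M'.law L s₀ T).real E * Real.sqrt T * w ^ 2
        = (M'.law L s₀ T).real E * w ^ 2 * Real.sqrt T := by ring
      _ ≤ w * (1 + 2 * H') * (Real.sqrt T * Real.sqrt T) + T * (2 * H) ^ 2 * Real.sqrt T := by
          linarith
      _ ≤ w * (1 + 2 * H') * T + T * (2 * H) ^ 2 * T := by
          rw [hss]
          gcongr
      _ = _ := by
          rw [hT4]
          field_simp
          ring
  exact le_of_mul_le_mul_right hfin (by positivity)

end

end CoExploration

/-! ### Visits grow faster than the logarithm -/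

open CoExploration in
theorem mainTheorem4 {S : Type u} [Finite S] [MeasurableSpace S] [DiscreteMeasurableSpace S]
    {A : S → Type u} [∀ s, Finite (A s)]
    (models : Set (CoExploration.MDP S A)) (M : CoExploration.MDP S A) (hM : M ∈ models)
    (hcomm : M.Communicating)
    (x : CoExploration.Pair A) (hx : M.IsOptimalPair x)
    (hclose : ∀ ε : ℝ, 0 < ε → ∃ M' ∈ models,
      M.DiffersOnlyInRewardAt M' x ∧ M.meanReward x < M'.meanReward x ∧
        InformationTheory.klDiv (M.reward x) (M'.reward x) < ENNReal.ofReal ε)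
    (L : CoExploration.Learner A) (hL : L.Consistent models) (s₀ : S) :
    Tendsto (fun T : ℕ => M.expVisits L s₀ x T / Real.log T) atTop atTop := by
  obtain ⟨π, hπ, hrec⟩ := hx
  have hA : ∀ s, ∃ y : Pair A, y.state = s := fun s => (π.available s).exists
  obtain ⟨g, φ, hgφ⟩ := hcomm.exists_optimalityEquation hA
  refine tendsto_atTop.2 fun b => ?_
  set K := max b 1 with hK
  have hK0 : 0 < K := lt_max_of_lt_right one_pos
  -- `K log T` visits then carry a relative entropy of at most `(log T) / 8`
  obtain ⟨M', hM', hd, hlt, hkl⟩ := hclose (1 / (8 * K)) (by positivity)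
  have hcomm' : M'.Communicating := by
    rw [MDP.Communicating, hd.1]
    exact hcomm
  obtain ⟨g', φ', hgφ'⟩ := hcomm'.exists_optimalityEquation hA
  have hg : g < g' := (hgφ.le_optGain x.state).trans_lt
    ((hπ x.state).symm.trans_lt (hgφ'.gain_lt hd hlt hrec))
  obtain ⟨a, c, ha, hfew⟩ := hd.exists_measure_few_visits_le hlt hgφ hgφ' hg L s₀
    (hL M' hM' s₀ (1 / 2) (by norm_num))
  have hlog : Tendsto (fun T : ℕ => Real.log T) atTop atTop :=
    Real.tendsto_log_atTop.comp tendsto_natCast_atTop_atTop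
  have hlogT := (Real.isLittleO_log_id_atTop.comp_tendsto
    (tendsto_natCast_atTop_atTop (R := ℝ))).bound (show 0 < a / (2 * K) by positivity)
  filter_upwards [hfew, hlogT, hlog.eventually_gt_atTop 0,
    hlog.eventually_gt_atTop (8 * Real.log (1 + c)), eventually_ge_atTop 1]
    with T hfewT hlogT hlog0 hlogc hT1
  have hT1' : (1 : ℝ) ≤ T := by exact_mod_cast hT1
  rw [le_div_iff₀ hlog0]
  refine (mul_le_mul_of_nonneg_right (le_max_left b 1) hlog0.le).trans ?_
  by_contra! hN
  have hlogT' : K * Real.log T ≤ a * T / 2 := by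
    simp only [Function.comp_apply, id, Real.norm_eq_abs, abs_of_pos hlog0, Nat.abs_cast] at hlogT
    calc K * Real.log T ≤ K * (a / (2 * K) * T) := mul_le_mul_of_nonneg_left hlogT hK0.le
      _ = a * T / 2 := by field_simp
  have hE : MeasurableSet {h : Hist A T | (h.visits x : ℝ) < a * T} :=
    measurableSet_lt (measurable_visits x T) measurable_const
  -- Markov's inequality
  have hhalf : 1 / 2 ≤ (M.law L s₀ T).real {h | (h.visits x : ℝ) < a * T} := by
    classical
    have hint : Integrable (fun h : Hist A T => (h.visits x : ℝ)) (M.law L s₀ T) := by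
      simp only [Hist.visits_eq_obsSum]
      exact M.integrable_obsSum_fst L s₀ (fun y => if y = x then 1 else 0) T
    have hmarkov := mul_meas_ge_le_integral_of_nonneg
      (Eventually.of_forall fun h : Hist A T => Nat.cast_nonneg (α := ℝ) (h.visits x)) hint (a * T)
    have hcompl := probReal_add_probReal_compl (μ := M.law L s₀ T) hE
    have hset : {h : Hist A T | (h.visits x : ℝ) < a * T}ᶜ = {h | a * T ≤ (h.visits x : ℝ)} := by
      ext h
      simp
    rw [hset] at hcompl
    change a * T * (M.law L s₀ T).real _ ≤ M.expVisits L s₀ x T at hmarkov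
    have haT : 0 < a * T := by positivity
    by_contra! hcon
    nlinarith
  have hkl' := hkl.ne_top
  have hbound := (hd.entropyBound_law hkl' L s₀ T).log_le hE hT1' hhalf hfewT
  have hklR : (InformationTheory.klDiv (M.reward x) (M'.reward x)).toReal ≤ 1 / (8 * K) :=
    ENNReal.toReal_le_of_le_ofReal (by positivity) hkl.le
  have hN0 : 0 ≤ M.expVisits L s₀ x T := integral_nonneg fun h => Nat.cast_nonneg _
  have hprod : (InformationTheory.klDiv (M.reward x) (M'.reward x)).toReal *
      M.expVisits L s₀ x T ≤ Real.log T / 8 := by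
    calc _ ≤ 1 / (8 * K) * (K * Real.log T) := mul_le_mul hklR hN.le hN0 (by positivity)
      _ = Real.log T / 8 := by field_simp
  linarith
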